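/- Let $K\subset\mathbf C$ be an imaginary quadratic field of class number $1$, with ring of integers $\mathcal O$, discriminant $D<0$ and norm $N$. Write $e(z)=e^{2\pi i z}$, and let $\chi_D=\left(\frac{D}{\cdot}\right)$ be the Kronecker symbol. For integers $k,m\ge 1$ let $\mathcal J_{k,m}$ be the space of Hermitian Jacobi forms of weight $k$ and index $m$, that is, of the holomorphic functions $\phi:\mathcal H\times\mathbf C^2\to\mathbf C$ ($\mathcal H$ the upper half-plane) such that (i) for all $\varepsilon\in\mathcal O^\times$ and all $M=\begin{pmatrix}a&b\\c&d\end{pmatrix}\in\mathrm{SL}_2(\mathbf Z)$, $$\varepsilon^{-k}(c\tau+d)^{-k}\,e\!\left(\tfrac{-mcz_1z_2}{c\tau+d}\right)\phi\!\left(\tfrac{a\tau+b}{c\tau+d},\tfrac{\varepsilon z_1}{c\tau+d},\tfrac{\bar\varepsilon z_2}{c\tau+d}\right)=\phi(\tau,z_1,z_2);$$ (ii) for all $\lambda,\mu\in\mathcal O$, $$e\big(m(N(\lambda)\tau+\bar\lambda z_1+\lambda z_2)\big)\,\phi(\tau,z_1+\lambda\tau+\mu,z_2+\bar\lambda\tau+\bar\mu)=\phi(\tau,z_1,z_2);$$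 (iii) $\phi$ has a Fourier expansion $$\phi(\tau,z_1,z_2)=\sum_{n\ge 0}\ \sum_{r\in\mathcal O,\ N(r)\le |D|nm}c_\phi(n,r)\,e\!\left(n\tau+\tfrac{ir}{\sqrt{|D|}}z_1+\tfrac{\overline{ir}}{\sqrt{|D|}}z_2\right).$$ For $s\in\mathcal O$, the theta component $h_s$ of $\phi\in\mathcal J_{k,m}$ is $$h_s(\tau)=\sum_{n\ge 0,\ |D|m\,\mid\, n+N(s)}c_\phi\!\left(\tfrac{n+N(s)}{|D|m},s\right)e\!\left(\tfrac{n\tau}{|D|m}\right).$$ For nonzero $\rho\in\mathcal O$, the operator $U_\rho$ is $(\phi|U_\rho)(\tau,z_1,z_2)=\phi(\tau,\rho z_1,\bar\rho z_2)$. Let $p$ be a prime number with $\chi_D(p)=1$ (that is, $p$ splits in $K$), and let $p=\pi\bar\pi$ with $\pi\in\mathcal O$ prime. Let $\phi\in\mathcal J_{k,p}$ be such that $h_s=0$ for every $s\in\mathcal O$ that is coprime to $i\sqrt{|D|}\,p$ in $\mathcal O$. Then $$\phi\in\mathcal J_{k,1}|U_\pi+\mathcal J_{k,1}|U_{\bar\pi};$$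 that is, $\phi=\phi_1|U_\pi+\phi_2|U_{\bar\pi}$ for some $\phi_1,\phi_2\in\mathcal J_{k,1}$, so that $\phi$ comes from Hermitian Jacobi forms of index $1$. -/

import Mathlib

namespace HermitianJacobi

/-- `e(z) = exp(2πiz)`. -/
noncomputable def e (z : ℂ) : ℂ := Complex.exp (2 * Real.pi * Complex.I * z)

/-- `√|D|`, where `D` is the discriminant of `K`. -/
noncomputable def sqrtAbsDiscr (K : Type*) [Field K] [NumberField K] : ℝ :=
  Real.sqrt |(NumberField.discr K : ℝ)|

/-- The norm `N(r)` of an integer `r` of an imaginary quadratic field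
(there the norm is nonnegative, so that it is a natural number). -/
noncomputable def nrm {K : Type*} [Field K] [NumberField K] (r : NumberField.RingOfIntegers K) :
    ℕ := (Algebra.norm ℤ r).natAbs

/-- In an imaginary quadratic field the trace is `x + x̄`. -/
theorem trace_eq_add_conj {K : Type*} [Field K] [NumberField K]
    [Algebra.IsQuadraticExtension ℚ K] [NumberField.IsTotallyComplex K] (σ : K →+* ℂ)
    (x : NumberField.RingOfIntegers K) :
    ((Algebra.trace ℤ (NumberField.RingOfIntegers K) x : ℤ) : ℂ)
      = σ x + starRingEnd ℂ (σ x) := by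
  classical
  have hne : σ ≠ NumberField.ComplexEmbedding.conjugate σ := by
    intro h
    have h1 := NumberField.IsTotallyComplex.isComplex (NumberField.InfinitePlace.mk σ)
    rw [NumberField.InfinitePlace.isComplex_mk_iff] at h1
    exact h1 h.symm
  have hcard : Fintype.card (K →ₐ[ℚ] ℂ) = 2 := by
    rw [AlgHom.card, Algebra.IsQuadraticExtension.finrank_eq_two]
  have hne' : σ.toRatAlgHom ≠ (NumberField.ComplexEmbedding.conjugate σ).toRatAlgHom := by
    intro h
    apply hne
    ext y
    exact DFunLike.congr_fun h y
  have huniv : (Finset.univ : Finset (K →ₐ[ℚ] ℂ)) =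
      {σ.toRatAlgHom, (NumberField.ComplexEmbedding.conjugate σ).toRatAlgHom} := by
    symm
    apply Finset.eq_univ_of_card
    rw [hcard, Finset.card_pair hne']
  have h2 := trace_eq_sum_embeddings (K := ℚ) (L := K) ℂ (x := (x : K))
  rw [huniv, Finset.sum_pair hne', ← Algebra.coe_trace_int] at h2
  simpa using h2

/-- `i√|D|` belongs to the ring of integers. -/
theorem exists_sqrtDiscr {K : Type*} [Field K] [NumberField K]
    [Algebra.IsQuadraticExtension ℚ K] [NumberField.IsTotallyComplex K] (σ : K →+* ℂ) :
    ∃ δ : NumberField.RingOfIntegers K, σ δ = Complex.I * sqrtAbsDiscr K := by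
  classical
  have hfr : Module.finrank ℚ K = 2 := Algebra.IsQuadraticExtension.finrank_eq_two ℚ K
  let b : Module.Basis (Fin 2) ℤ (NumberField.RingOfIntegers K) :=
    Module.finBasisOfFinrankEq ℤ (NumberField.RingOfIntegers K)
      (by rw [NumberField.RingOfIntegers.rank, hfr])
  let tr := Algebra.trace ℤ (NumberField.RingOfIntegers K)
  have hD : NumberField.discr K = tr (b 0 * b 0) * tr (b 1 * b 1) -
      tr (b 0 * b 1) * tr (b 1 * b 0) := by
    rw [← NumberField.discr_eq_discr K b, Algebra.discr_def, Matrix.det_fin_two]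
    rfl
  have hneg : NumberField.discr K < 0 := by
    have h1 := NumberField.sign_discr K
    have h2 := NumberField.IsTotallyComplex.finrank K
    have h3 : NumberField.InfinitePlace.nrComplexPlaces K = 1 := by omega
    rw [h3, pow_one] at h1
    exact Int.sign_eq_neg_one_iff_neg.mp h1
  have hDC : (NumberField.discr K : ℂ) = (Complex.I * sqrtAbsDiscr K) ^ 2 := by
    rw [mul_pow, Complex.I_sq, ← Complex.ofReal_pow, sqrtAbsDiscr, Real.sq_sqrt (abs_nonneg _),
      abs_of_neg (by exact_mod_cast hneg)]
    push_cast
    ring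
  let d := b 0 * ((tr (b 1) : ℤ) - b 1) - ((tr (b 0) : ℤ) - b 0) * b 1
  have hd : σ d = σ (b 0) * starRingEnd ℂ (σ (b 1)) - starRingEnd ℂ (σ (b 0)) * σ (b 1) := by
    have t0 := trace_eq_add_conj σ (b 0)
    have t1 := trace_eq_add_conj σ (b 1)
    simp only [d, map_sub, map_mul, map_intCast]
    rw [t0, t1]
    ring
  have hsq : (σ d) ^ 2 = (Complex.I * sqrtAbsDiscr K) ^ 2 := by
    rw [← hDC, hD, hd]
    push_cast
    simp only [tr]
    rw [trace_eq_add_conj σ, trace_eq_add_conj σ, trace_eq_add_conj σ, trace_eq_add_conj σ]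
    simp only [map_mul]
    ring
  rcases sq_eq_sq_iff_eq_or_eq_neg.mp hsq with h | h
  · exact ⟨d, h⟩
  · exact ⟨-d, by simp [h]⟩

/-- The element `i√|D|` of the ring of integers; it generates the different. -/
noncomputable def sqrtDiscr {K : Type*} [Field K] [NumberField K]
    [Algebra.IsQuadraticExtension ℚ K] [NumberField.IsTotallyComplex K] (σ : K →+* ℂ) :
    NumberField.RingOfIntegers K := (exists_sqrtDiscr σ).choose

theorem sqrtDiscr_spec {K : Type*} [Field K] [NumberField K]
    [Algebra.IsQuadraticExtension ℚ K] [NumberField.IsTotallyComplex K] (σ : K →+* ℂ) :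
    σ (sqrtDiscr σ) = Complex.I * sqrtAbsDiscr K := (exists_sqrtDiscr σ).choose_spec

/-- The value at a prime `p` of the Kronecker symbol `χ_D = (D / ·)`, for a discriminant `D`. -/
def kroneckerAtPrime (D : ℤ) (p : ℕ) : ℤ :=
  if p = 2 then ZMod.χ₈ (D : ZMod 8) else jacobiSym D p

/-- The action `φ ↦ φ|_{k,m} εM` for a complex number `ε` of absolute value one
and `M` in `SL₂(ℤ)`. -/
noncomputable def slashU (k : ℤ) (m : ℕ) (ε : ℂ) (M : Matrix.SpecialLinearGroup (Fin 2) ℤ)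
    (φ : UpperHalfPlane → ℂ → ℂ → ℂ) : UpperHalfPlane → ℂ → ℂ → ℂ :=
  fun τ z₁ z₂ =>
    ε ^ (-k) * ((M 1 0 : ℂ) * τ + (M 1 1 : ℂ)) ^ (-k) *
      e (-(m * (M 1 0 : ℂ) * z₁ * z₂ / ((M 1 0 : ℂ) * τ + (M 1 1 : ℂ)))) *
      φ (M • τ) (ε * z₁ / ((M 1 0 : ℂ) * τ + (M 1 1 : ℂ)))
        (starRingEnd ℂ ε * z₂ / ((M 1 0 : ℂ) * τ + (M 1 1 : ℂ)))

/-- The action `φ ↦ φ|_m [(l, u), 1]` of a pair `(l, u)` of complex numbers. -/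
noncomputable def slashH (m : ℕ) (l u : ℂ) (φ : UpperHalfPlane → ℂ → ℂ → ℂ) :
    UpperHalfPlane → ℂ → ℂ → ℂ :=
  fun τ z₁ z₂ =>
    e (m * (l * starRingEnd ℂ l * τ + starRingEnd ℂ l * z₁ + l * z₂)) *
      φ τ (z₁ + l * τ + u) (z₂ + starRingEnd ℂ l * τ + starRingEnd ℂ u)

/-- Holomorphy on the product of the upper half-plane and `ℂ²`. -/
def IsHolomorphic (φ : UpperHalfPlane → ℂ → ℂ → ℂ) : Prop :=
  DifferentiableOn ℂ (fun w : ℂ × ℂ × ℂ => φ (UpperHalfPlane.ofComplex w.1) w.2.1 w.2.2)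
    {w : ℂ × ℂ × ℂ | 0 < w.1.im}

/-- `φ(τ, z₁, z₂) = ∑ c(n, r) e(nτ + (ir/√|D|) z₁ + conj(ir/√|D|) z₂)`, the sum being over
all `n ≥ 0` and all integers `r` of `K` with `N(r) ≤ |D|nm`. -/
def HasFourierExpansion {K : Type*} [Field K] [NumberField K] (σ : K →+* ℂ) (m : ℕ)
    (φ : UpperHalfPlane → ℂ → ℂ → ℂ) (c : ℕ → NumberField.RingOfIntegers K → ℂ) : Prop :=
  (∀ n r, c n r ≠ 0 → nrm r ≤ (NumberField.discr K).natAbs * n * m) ∧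
  ∀ (τ : UpperHalfPlane) (z₁ z₂ : ℂ),
    HasSum (fun q : ℕ × NumberField.RingOfIntegers K =>
      c q.1 q.2 * e (q.1 * τ + Complex.I * σ q.2 / sqrtAbsDiscr K * z₁ +
        starRingEnd ℂ (Complex.I * σ q.2 / sqrtAbsDiscr K) * z₂)) (φ τ z₁ z₂)

/-- The complex vector space `J_{k,m}` of Hermitian Jacobi forms of weight `k` and index `m`
over the ring of integers of the imaginary quadratic field `K`, embedded into `ℂ` by `σ`.
Invariance under the Hermitian Jacobi group is invariance under its two factors. -/
noncomputable def jacobiForms {K : Type*} [Field K] [NumberField K] (σ : K →+* ℂ)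
    (k : ℤ) (m : ℕ) : Submodule ℂ (UpperHalfPlane → ℂ → ℂ → ℂ) where
  carrier := {φ | IsHolomorphic φ ∧
    (∀ (ε : (NumberField.RingOfIntegers K)ˣ) (M : Matrix.SpecialLinearGroup (Fin 2) ℤ),
      slashU k m (σ (ε : NumberField.RingOfIntegers K)) M φ = φ) ∧
    (∀ l u : NumberField.RingOfIntegers K, slashH m (σ l) (σ u) φ = φ) ∧
    ∃ c, HasFourierExpansion σ m φ c}
  zero_mem' := by
    refine ⟨?_, fun ε M => ?_, fun l u => ?_, 0, fun n r h => absurd rfl h, fun τ z₁ z₂ => ?_⟩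
    · exact differentiableOn_const 0
    · funext τ z₁ z₂
      simp [slashU]
    · funext τ z₁ z₂
      simp [slashH]
    · simp
  add_mem' := by
    rintro φ ψ ⟨h1, h2, h3, c, hc1, hc2⟩ ⟨g1, g2, g3, d, hd1, hd2⟩
    refine ⟨DifferentiableOn.add h1 g1, fun ε M => ?_, fun l u => ?_, c + d, fun n r h => ?_,
      fun τ z₁ z₂ => ?_⟩
    · conv_rhs => rw [← h2 ε M, ← g2 ε M]
      funext τ z₁ z₂
      simp only [slashU, Pi.add_apply]
      ring
    · conv_rhs => rw [← h3 l u, ← g3 l u]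
      funext τ z₁ z₂
      simp only [slashH, Pi.add_apply]
      ring
    · by_cases hcz : c n r = 0
      · refine hd1 n r fun hdz => h ?_
        simp [hcz, hdz]
      · exact hc1 n r hcz
    · simpa [add_mul] using (hc2 τ z₁ z₂).add (hd2 τ z₁ z₂)
  smul_mem' := by
    rintro a φ ⟨h1, h2, h3, c, hc1, hc2⟩
    refine ⟨DifferentiableOn.const_smul h1 a, fun ε M => ?_, fun l u => ?_, a • c, fun n r h => ?_,
      fun τ z₁ z₂ => ?_⟩
    · conv_rhs => rw [← h2 ε M]
      funext τ z₁ z₂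
      simp only [slashU, Pi.smul_apply, smul_eq_mul]
      ring
    · conv_rhs => rw [← h3 l u]
      funext τ z₁ z₂
      simp only [slashH, Pi.smul_apply, smul_eq_mul]
      ring
    · exact hc1 n r fun hcz => h (by simp [hcz])
    · simpa [mul_assoc] using (hc2 τ z₁ z₂).mul_left a

open Classical in
/-- The Fourier coefficients `c_φ(n, r)`: the (unique) coefficients of a Fourier expansion
of `φ`. -/
noncomputable def fourierCoeff {K : Type*} [Field K] [NumberField K] (σ : K →+* ℂ) (m : ℕ)
    (φ : UpperHalfPlane → ℂ → ℂ → ℂ) : ℕ → NumberField.RingOfIntegers K → ℂ :=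
  if h : ∃ c, HasFourierExpansion σ m φ c then h.choose else 0

/-- The theta component `h_s(τ) = ∑ c_φ((n + N(s)) / (|D|m), s) e(nτ / (|D|m))`, the sum being
over all `n ≥ 0` with `n + N(s)` divisible by `|D|m`. -/
noncomputable def thetaComponent {K : Type*} [Field K] [NumberField K] (σ : K →+* ℂ) (m : ℕ)
    (φ : UpperHalfPlane → ℂ → ℂ → ℂ) (s : NumberField.RingOfIntegers K)
    (τ : UpperHalfPlane) : ℂ :=
  ∑' n : ℕ,
    if (NumberField.discr K).natAbs * m ∣ n + nrm s then
      fourierCoeff σ m φ ((n + nrm s) / ((NumberField.discr K).natAbs * m)) s *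
        e (n * τ / ((NumberField.discr K).natAbs * m))
    else 0

/-- The operator `U_ρ`: `(φ|U_ρ)(τ, z₁, z₂) = φ(τ, ρz₁, ρ̄z₂)`. -/
noncomputable def opU (ρ : ℂ) :
    (UpperHalfPlane → ℂ → ℂ → ℂ) →ₗ[ℂ] (UpperHalfPlane → ℂ → ℂ → ℂ) where
  toFun φ := fun τ z₁ z₂ => φ τ (ρ * z₁) (starRingEnd ℂ ρ * z₂)
  map_add' _ _ := rfl
  map_smul' _ _ := rfl

end HermitianJacobi

namespace HermitianJacobi

open NumberField Complex
open scoped ComplexConjugate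

/-! ### Conjugation, norm, and the self-dual trace form of the different. -/

section Arithmetic

set_option linter.unusedSectionVars false

variable {K : Type*} [Field K] [NumberField K]

/-! Write `δ = i√|D|`. In index `m` the operators `opA m l` and `opB u` satisfy the Heisenberg
relation: they commute up to the scalar `e(m·tr(l ū))`, and `SL₂(ℤ)` acts on the row vectors `(l,
u)` up to a quadratic phase (`opS_opA_opB`). Since `opB` multiplies the coefficient at `r` by an
additive character of `r`, support conditions on `r` become invariance statements for `opB`, and
conversely.

The different is removed first. Let `w` be a prime divisor of `δ`, and let `η` be a multiple of `p`
that `w` does not divide. The part `f` of `φ` carried by the `r` coprime to `η` is a combination of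
translates of `φ` by `a/η`, hence fixed by the unipotent matrices of level `N(η)²`. If the
coefficients at the `r` coprime to `wη` vanish, then `f` lives on multiples of `w`, so it is fixed
by the translations by `𝓞/w`. Together these invariances give `f = e(p N(η)⁶/N(w)) f`; the exponent
is not an integer because `w ∣ w̄` and `w ∤ η`, so `f = 0`. Peeling off the primes of `δ` one by one
leaves an expansion supported on the `r` divisible by `ρ` or by `ρ̄`, where `p = ρρ̄`
(`exists_expansion_of_vanish`).

At `p`, the multiples of `1/ρ` and those of `1/ρ̄` give commuting operators each, but pair
nontrivially with each other. Let `Π_ρ` be the average of the operators over `1/ρ`. Then `φ` can be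
rebuilt from the `p²` functions obtained by applying `Π_ρ` to its translates by `(x, y)/ρ̄`
(`eq_sum_component`). The support condition forces all of these with `(x, y) ≢ 0` modulo `ρ̄` to be
one function `G`: for `x ≢ 0` the average selects a nonzero class of `r` modulo `ρ`, on which `ρ̄ ∣
r`, so that `y` has no influence; the matrix `S` exchanges the roles of `x` and `y`. Hence `φ = (Π_ρ
φ - G) + p² Π_ρ̄ G` (`eq_add_component`).

The first summand is fixed by the operators of `1/ρ`, the second by those of `1/ρ̄`, and both are
images of index one functions under `U_ρ` and `U_ρ̄`. A function fixed by both families is zero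
(`eq_zero_of_mem`), so the decomposition is unique and each summand inherits the invariance under
the units and `SL₂(ℤ)`. This is assembled in `mem_sup_map`. -/

theorem sqrtAbsDiscr_pos : 0 < sqrtAbsDiscr K :=
  Real.sqrt_pos.mpr (abs_pos.mpr (by exact_mod_cast discr_ne_zero K))

theorem sqrtAbsDiscr_sq : (sqrtAbsDiscr K : ℂ) ^ 2 = ((discr K).natAbs : ℂ) := by
  rw [← ofReal_pow, sqrtAbsDiscr, Real.sq_sqrt (abs_nonneg _)]
  rw [Nat.cast_natAbs, ← Int.cast_abs, ofReal_intCast]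

theorem I_mul_sqrtAbsDiscr_ne_zero : I * (sqrtAbsDiscr K : ℂ) ≠ 0 :=
  mul_ne_zero I_ne_zero (by exact_mod_cast (sqrtAbsDiscr_pos (K := K)).ne')

theorem I_mul_sqrtAbsDiscr_sq :
    (I * (sqrtAbsDiscr K : ℂ)) ^ 2 = -((discr K).natAbs : ℂ) := by
  rw [mul_pow, I_sq, sqrtAbsDiscr_sq]
  ring

theorem conj_I_mul_sqrtAbsDiscr :
    conj (I * (sqrtAbsDiscr K : ℂ)) = -(I * (sqrtAbsDiscr K : ℂ)) := by
  simp

theorem emb_inj (σ : K →+* ℂ) {x y : 𝓞 K} : σ x = σ y ↔ x = y :=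
  σ.injective.eq_iff.trans RingOfIntegers.ext_iff.symm

theorem emb_add (σ : K →+* ℂ) (x y : 𝓞 K) : σ ((x + y : 𝓞 K) : K) = σ x + σ y := by
  simp

theorem emb_sub (σ : K →+* ℂ) (x y : 𝓞 K) : σ ((x - y : 𝓞 K) : K) = σ x - σ y := by
  simp

theorem emb_mul (σ : K →+* ℂ) (x y : 𝓞 K) : σ ((x * y : 𝓞 K) : K) = σ x * σ y := by
  simp

theorem emb_natCast (σ : K →+* ℂ) (n : ℕ) : σ ((n : 𝓞 K) : K) = n := by
  simp

theorem emb_intCast (σ : K →+* ℂ) (n : ℤ) : σ ((n : 𝓞 K) : K) = n := by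
  simp

theorem emb_eq_zero (σ : K →+* ℂ) {x : 𝓞 K} : σ x = 0 ↔ x = 0 := by
  rw [← emb_inj σ (x := x)]
  simp

/-- The conjugate `x̄` of an integer of a quadratic field. -/
noncomputable def bar (x : 𝓞 K) : 𝓞 K := (Algebra.trace ℤ (𝓞 K) x : 𝓞 K) - x

variable (K) in
/-- The trace form `w ↦ tr(w / (i√|D|))`, extended to the complex numbers. -/
noncomputable def trDiff (w : ℂ) : ℂ := (w - conj w) / (I * sqrtAbsDiscr K)

theorem trDiff_add (w w' : ℂ) : trDiff K (w + w') = trDiff K w + trDiff K w' := by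
  simp only [trDiff, map_add]
  ring

variable [Algebra.IsQuadraticExtension ℚ K] [IsTotallyComplex K]

theorem discr_neg : discr K < 0 := by
  have h1 := sign_discr K
  have h2 := IsTotallyComplex.finrank K
  have h4 : Module.finrank ℚ K = 2 := Algebra.IsQuadraticExtension.finrank_eq_two ℚ K
  have h3 : InfinitePlace.nrComplexPlaces K = 1 := by omega
  rw [h3, pow_one] at h1
  exact Int.sign_eq_neg_one_iff_neg.mp h1

theorem map_bar (σ : K →+* ℂ) (x : 𝓞 K) : σ (bar x) = conj (σ x) := by
  simp only [bar, map_sub, map_intCast]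
  rw [trace_eq_add_conj σ]
  ring

theorem exists_emb : ∃ _σ : K →+* ℂ, True := ⟨Classical.arbitrary _, trivial⟩

@[simp] theorem bar_bar (x : 𝓞 K) : bar (bar x) = x := by
  obtain ⟨σ, -⟩ := exists_emb (K := K)
  rw [← emb_inj σ]
  simp [map_bar]

theorem bar_mul (x y : 𝓞 K) : bar (x * y) = bar x * bar y := by
  obtain ⟨σ, -⟩ := exists_emb (K := K)
  rw [← emb_inj σ]
  simp [map_bar]

theorem bar_add (x y : 𝓞 K) : bar (x + y) = bar x + bar y := by
  obtain ⟨σ, -⟩ := exists_emb (K := K)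
  rw [← emb_inj σ]
  simp [map_bar]

theorem bar_intCast (n : ℤ) : bar (n : 𝓞 K) = n := by
  obtain ⟨σ, -⟩ := exists_emb (K := K)
  rw [← emb_inj σ]
  simp [map_bar]

theorem bar_dvd {x y : 𝓞 K} (h : x ∣ y) : bar x ∣ bar y := by
  obtain ⟨z, rfl⟩ := h
  exact ⟨bar z, bar_mul _ _⟩

theorem bar_prime {x : 𝓞 K} (h : Prime x) : Prime (bar x) := by
  have h0 : bar (0 : 𝓞 K) = 0 := by simpa using bar_intCast (K := K) 0
  have h1 : bar (1 : 𝓞 K) = 1 := by simpa using bar_intCast (K := K) 1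
  refine ⟨fun h' => h.ne_zero ?_, fun h' => h.not_isUnit ?_, fun a b hab => ?_⟩
  · rw [← bar_bar x, h', h0]
  · rw [isUnit_iff_dvd_one] at h' ⊢
    simpa [h1] using bar_dvd h'
  · have := bar_dvd hab
    rw [bar_bar, bar_mul] at this
    rcases h.dvd_or_dvd this with h | h
    · left; simpa using bar_dvd h
    · right; simpa using bar_dvd h

theorem add_bar (x : 𝓞 K) : x + bar x = (Algebra.trace ℤ (𝓞 K) x : 𝓞 K) := by
  simp [bar]

theorem nrm_eq (σ : K →+* ℂ) (x : 𝓞 K) : (nrm x : ℂ) = σ x * conj (σ x) := by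
  classical
  have hne : σ ≠ ComplexEmbedding.conjugate σ := by
    intro h
    have h1 := IsTotallyComplex.isComplex (InfinitePlace.mk σ)
    rw [InfinitePlace.isComplex_mk_iff] at h1
    exact h1 h.symm
  have hcard : Fintype.card (K →ₐ[ℚ] ℂ) = 2 := by
    rw [AlgHom.card, Algebra.IsQuadraticExtension.finrank_eq_two]
  have hne' : σ.toRatAlgHom ≠ (ComplexEmbedding.conjugate σ).toRatAlgHom := by
    intro h
    apply hne
    ext y
    exact DFunLike.congr_fun h y
  have huniv : (Finset.univ : Finset (K →ₐ[ℚ] ℂ)) =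
      {σ.toRatAlgHom, (ComplexEmbedding.conjugate σ).toRatAlgHom} := by
    symm
    apply Finset.eq_univ_of_card
    rw [hcard, Finset.card_pair hne']
  have h2 := Algebra.norm_eq_prod_embeddings ℚ ℂ (x : K)
  rw [huniv, Finset.prod_pair hne', ← Algebra.coe_norm_int] at h2
  have h3 : ((Algebra.norm ℤ x : ℤ) : ℂ) = σ x * conj (σ x) := by simpa using h2
  have h4 : 0 ≤ Algebra.norm ℤ x := by
    rw [mul_conj] at h3
    have : ((Algebra.norm ℤ x : ℤ) : ℝ) = normSq (σ x) := by exact_mod_cast h3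
    have h5 := normSq_nonneg (σ x)
    rw [← this] at h5
    exact_mod_cast h5
  rw [← h3, nrm]
  conv_rhs => rw [← Int.natAbs_of_nonneg h4]
  simp

theorem natCast_nrm (x : 𝓞 K) : (nrm x : 𝓞 K) = x * bar x := by
  obtain ⟨σ, -⟩ := exists_emb (K := K)
  rw [← emb_inj σ]
  simp [map_bar, nrm_eq σ]

theorem nrm_mul (x y : 𝓞 K) : nrm (x * y) = nrm x * nrm y := by
  simp [nrm, Int.natAbs_mul]

/-- The determinant formed by a basis and its conjugates has square `D`; swapping the two basis
vectors corrects its sign. -/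
theorem exists_basis (σ : K →+* ℂ) : ∃ b₀ b₁ : 𝓞 K,
    (∀ x : 𝓞 K, ∃ i j : ℤ, x = i * b₀ + j * b₁) ∧
      σ b₀ * conj (σ b₁) - conj (σ b₀) * σ b₁ = I * sqrtAbsDiscr K := by
  classical
  have hfr : Module.finrank ℚ K = 2 := Algebra.IsQuadraticExtension.finrank_eq_two ℚ K
  let b : Module.Basis (Fin 2) ℤ (𝓞 K) :=
    Module.finBasisOfFinrankEq ℤ (𝓞 K) (by rw [RingOfIntegers.rank, hfr])
  have hb : ∀ x : 𝓞 K, ∃ i j : ℤ, x = i * b 0 + j * b 1 := fun x =>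
    ⟨b.repr x 0, b.repr x 1, by
      conv_lhs => rw [← b.sum_repr x]
      simp [Fin.sum_univ_two]⟩
  let tr := Algebra.trace ℤ (𝓞 K)
  have hD : discr K = tr (b 0 * b 0) * tr (b 1 * b 1) - tr (b 0 * b 1) * tr (b 1 * b 0) := by
    rw [← discr_eq_discr K b, Algebra.discr_def, Matrix.det_fin_two]
    rfl
  have hneg := discr_neg (K := K)
  have hsq : (σ (b 0) * conj (σ (b 1)) - conj (σ (b 0)) * σ (b 1)) ^ 2
      = (I * sqrtAbsDiscr K) ^ 2 := by
    have : (discr K : ℂ) = -((discr K).natAbs : ℂ) := by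
      have h : discr K = -((discr K).natAbs : ℤ) := by omega
      conv_lhs => rw [h]
      simp
    rw [I_mul_sqrtAbsDiscr_sq, ← this, hD]
    push_cast
    simp only [tr]
    rw [trace_eq_add_conj σ, trace_eq_add_conj σ, trace_eq_add_conj σ, trace_eq_add_conj σ]
    simp only [map_mul]
    ring
  rcases sq_eq_sq_iff_eq_or_eq_neg.mp hsq with h | h
  · exact ⟨b 0, b 1, hb, h⟩
  · refine ⟨b 1, b 0, fun x => ?_, ?_⟩
    · obtain ⟨i, j, h⟩ := hb x
      exact ⟨j, i, by rw [h]; ring⟩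
    · linear_combination -h

/-- Expanding `1 = i' b₀ + j' b₁` as well turns `(x - x̄)/δ` into the integer determinant `i j' - j
i'`. -/
theorem exists_trDiff_eq (σ : K →+* ℂ) (x : 𝓞 K) : ∃ n : ℤ, trDiff K (σ x) = n := by
  obtain ⟨b₀, b₁, hb, hd⟩ := exists_basis σ
  obtain ⟨i, j, rfl⟩ := hb x
  obtain ⟨i', j', h1⟩ := hb 1
  have h1' : (1 : ℂ) = i' * σ b₀ + j' * σ b₁ := by
    have := congrArg (fun y : 𝓞 K => σ y) h1
    simpa using this
  have h1'' : (1 : ℂ) = i' * conj (σ b₀) + j' * conj (σ b₁) := by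
    have := congrArg conj h1'
    simpa using this
  refine ⟨i * j' - j * i', ?_⟩
  rw [trDiff, div_eq_iff I_mul_sqrtAbsDiscr_ne_zero, ← hd]
  simp only [map_add, map_mul, map_intCast]
  push_cast
  linear_combination (i * σ b₀ + j * σ b₁) * h1'' - (i * conj (σ b₀) + j * conj (σ b₁)) * h1'

/-- The integer `tr(x / (i√|D|))`, for an integer `x` of `K`. -/
noncomputable def trDiffInt (σ : K →+* ℂ) (x : 𝓞 K) : ℤ := (exists_trDiff_eq σ x).choose

theorem trDiffInt_spec (σ : K →+* ℂ) (x : 𝓞 K) : trDiff K (σ x) = trDiffInt σ x :=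
  (exists_trDiff_eq σ x).choose_spec

theorem sub_bar (σ : K →+* ℂ) (x : 𝓞 K) : x - bar x = trDiffInt σ x * sqrtDiscr σ := by
  rw [← emb_inj σ]
  have := trDiffInt_spec σ x
  rw [trDiff, div_eq_iff I_mul_sqrtAbsDiscr_ne_zero] at this
  simpa [map_bar, sqrtDiscr_spec] using this

theorem bar_sqrtDiscr (σ : K →+* ℂ) : bar (sqrtDiscr σ) = -sqrtDiscr σ := by
  rw [← emb_inj σ]
  simp [map_bar, sqrtDiscr_spec]

/-- The lattice of the integers is its own dual under `(x, y) ↦ tr(xy / (i√|D|))`. -/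
theorem exists_eq_of_trDiff (σ : K →+* ℂ) (b₀ b₁ : 𝓞 K)
    (hd : σ b₀ * conj (σ b₁) - conj (σ b₀) * σ b₁ = I * sqrtAbsDiscr K) (y : ℂ)
    (h₀ : ∃ n : ℤ, trDiff K (y * σ b₀) = n) (h₁ : ∃ n : ℤ, trDiff K (y * σ b₁) = n) :
    ∃ r : 𝓞 K, y = σ r := by
  obtain ⟨n₀, h₀⟩ := h₀
  obtain ⟨n₁, h₁⟩ := h₁
  rw [trDiff, div_eq_iff I_mul_sqrtAbsDiscr_ne_zero] at h₀ h₁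
  -- Cramer's rule for the system `y bᵢ - ȳ b̄ᵢ = nᵢ δ` in the unknowns `y` and `ȳ`, whose
  -- determinant is `δ`.
  refine ⟨n₀ * bar b₁ - n₁ * bar b₀, ?_⟩
  apply mul_right_cancel₀ (I_mul_sqrtAbsDiscr_ne_zero (K := K))
  simp only [map_sub, map_mul, map_intCast, map_bar] at h₀ h₁ ⊢
  rw [← hd] at h₀ h₁ ⊢
  linear_combination conj (σ b₁) * h₀ - conj (σ b₀) * h₁

theorem exists_trDiff_ne (σ : K →+* ℂ) (y : ℂ) (hy : ∀ r : 𝓞 K, y ≠ σ r) :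
    ∃ a : 𝓞 K, ∀ n : ℤ, trDiff K (y * σ a) ≠ n := by
  obtain ⟨b₀, b₁, -, hd⟩ := exists_basis σ
  by_contra! h
  obtain ⟨r, hr⟩ := exists_eq_of_trDiff σ b₀ b₁ hd y (h b₀) (h b₁)
  exact hy r hr

/-- Since `x - x̄` is an integer multiple of `δ`, conjugation is trivial modulo a divisor of `δ`.
For a prime `w ∣ δ` this yields `w ∣ w̄`. -/
theorem dvd_bar_of_dvd_sqrtDiscr (σ : K →+* ℂ) {w x : 𝓞 K} (hw : w ∣ sqrtDiscr σ)
    (hx : w ∣ x) : w ∣ bar x := by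
  have h := sub_bar σ x
  have h2 : bar x = x - trDiffInt σ x * sqrtDiscr σ := by rw [← h]; ring
  rw [h2]
  exact dvd_sub hx (hw.mul_left _)

end Arithmetic

/-! ### Heisenberg translations, modular substitutions and `U_ρ` as linear operators. -/

section Operators

theorem e_add (z w : ℂ) : e (z + w) = e z * e w := by
  rw [e, e, e, ← Complex.exp_add]
  ring_nf

theorem e_zero : e 0 = 1 := by simp [e]

theorem e_neg (z : ℂ) : e (-z) = (e z)⁻¹ := by
  rw [e, e, ← Complex.exp_neg]
  ring_nf

theorem e_natCast_mul (n : ℕ) (z : ℂ) : e (n * z) = e z ^ n := by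
  rw [e, e, ← Complex.exp_nat_mul]
  ring_nf

theorem e_eq_one_iff (z : ℂ) : e z = 1 ↔ ∃ n : ℤ, z = n := by
  rw [e, Complex.exp_eq_one_iff]
  have h : 2 * (Real.pi : ℂ) * I ≠ 0 := two_pi_I_ne_zero
  refine exists_congr fun n => ⟨fun h' => ?_, fun h' => by rw [h']; ring⟩
  apply mul_left_cancel₀ h
  rw [h']
  ring

theorem e_intCast (n : ℤ) : e n = 1 := (e_eq_one_iff _).mpr ⟨n, rfl⟩

/-- The operator `φ ↦ φ|_m [(l, 0), 1]`. -/
noncomputable def opA (m : ℕ) (l : ℂ) :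
    (UpperHalfPlane → ℂ → ℂ → ℂ) →ₗ[ℂ] (UpperHalfPlane → ℂ → ℂ → ℂ) where
  toFun f := fun τ z₁ z₂ => e (m * (l * conj l * τ + conj l * z₁ + l * z₂)) *
    f τ (z₁ + l * τ) (z₂ + conj l * τ)
  map_add' f g := by funext τ z₁ z₂; simp [mul_add]
  map_smul' c f := by funext τ z₁ z₂; simp [mul_left_comm]

/-- The operator `φ ↦ φ|_m [(0, u), 1]`, which does not depend on `m`. -/
noncomputable def opB (u : ℂ) :
    (UpperHalfPlane → ℂ → ℂ → ℂ) →ₗ[ℂ] (UpperHalfPlane → ℂ → ℂ → ℂ) where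
  toFun f := fun τ z₁ z₂ => f τ (z₁ + u) (z₂ + conj u)
  map_add' _ _ := rfl
  map_smul' _ _ := rfl

/-- The operator `φ ↦ φ|_{k,m} εM`. -/
noncomputable def opS (k : ℤ) (m : ℕ) (ε : ℂ) (M : Matrix.SpecialLinearGroup (Fin 2) ℤ) :
    (UpperHalfPlane → ℂ → ℂ → ℂ) →ₗ[ℂ] (UpperHalfPlane → ℂ → ℂ → ℂ) where
  toFun f := slashU k m ε M f
  map_add' f g := by funext τ z₁ z₂; simp [slashU, mul_add]
  map_smul' c f := by funext τ z₁ z₂; simp [slashU, mul_left_comm]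

theorem opS_apply (k : ℤ) (m : ℕ) (ε : ℂ) (M : Matrix.SpecialLinearGroup (Fin 2) ℤ)
    (f : UpperHalfPlane → ℂ → ℂ → ℂ) : opS k m ε M f = slashU k m ε M f := rfl

variable (f : UpperHalfPlane → ℂ → ℂ → ℂ) (m : ℕ) (l l' u u' : ℂ)

theorem slashH_eq : slashH m l u f = opA m l (opB u f) := rfl

theorem opA_zero : opA m 0 f = f := by
  funext τ z₁ z₂
  simp [opA, e_zero]

theorem opB_zero : opB 0 f = f := by
  funext τ z₁ z₂
  simp [opB]

theorem opA_opA : opA m l (opA m l' f) = opA m (l + l') f := by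
  funext τ z₁ z₂
  simp only [opA, LinearMap.coe_mk, AddHom.coe_mk, ← mul_assoc, ← e_add, map_add]
  ring_nf

theorem opB_opB : opB u (opB u' f) = opB (u + u') f := by
  funext τ z₁ z₂
  simp only [opB, LinearMap.coe_mk, AddHom.coe_mk, map_add]
  ring_nf

theorem opA_comm : opA m l (opA m l' f) = opA m l' (opA m l f) := by
  rw [opA_opA, opA_opA, add_comm]

theorem opB_comm : opB u (opB u' f) = opB u' (opB u f) := by
  rw [opB_opB, opB_opB, add_comm]

/-- The Heisenberg relation. Where the scalar is `1` the operators can be averaged together; where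
it is not, a common fixed vector must vanish. -/
theorem opB_opA :
    opB u (opA m l f) = e (m * (l * conj u + conj l * u)) • opA m l (opB u f) := by
  funext τ z₁ z₂
  simp only [opA, opB, LinearMap.coe_mk, AddHom.coe_mk, Pi.smul_apply, smul_eq_mul,
    ← mul_assoc, ← e_add]
  ring_nf

/-- The semidirect product law of the Jacobi group: `(l, u)` is multiplied on the right by `M`, and
the scalar is the resulting cocycle. -/
theorem opS_opA_opB (k : ℤ) {ε : ℂ} (hε : ε * conj ε = 1)
    (M : Matrix.SpecialLinearGroup (Fin 2) ℤ) :
    opS k m ε M (opA m l (opB u f)) =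
      e (m * (M 0 0 * M 0 1 * (l * conj l) + M 1 0 * M 1 1 * (u * conj u) +
        M 0 1 * M 1 0 * (l * conj u + conj l * u))) •
        opA m (conj ε * (M 0 0 * l + M 1 0 * u)) (opB (conj ε * (M 0 1 * l + M 1 1 * u))
          (opS k m ε M f)) := by
  have hdet : (M 0 0 : ℂ) * M 1 1 - M 0 1 * M 1 0 = 1 := by
    have := M.det_coe
    rw [Matrix.det_fin_two] at this
    exact_mod_cast this
  funext τ z₁ z₂
  have hJ : (M 1 0 : ℂ) * τ + (M 1 1 : ℂ) ≠ 0 := by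
    have := UpperHalfPlane.denom_ne_zero (M : GL (Fin 2) ℝ) τ
    simpa [UpperHalfPlane.denom] using this
  have hτ : ((M • τ : UpperHalfPlane) : ℂ) = (M 0 0 * τ + M 0 1) / (M 1 0 * τ + M 1 1) := by
    rw [UpperHalfPlane.coe_specialLinearGroup_apply]
    simp
  have hε0 : ε ≠ 0 := left_ne_zero_of_mul_eq_one hε
  have hε' : conj ε = ε⁻¹ := eq_inv_of_mul_eq_one_right hε
  simp only [opA, opB, opS, slashU, LinearMap.coe_mk, AddHom.coe_mk, Pi.smul_apply, smul_eq_mul,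
    map_mul, map_add, map_intCast, hτ, hε', map_inv₀]
  generalize M • τ = τ'
  generalize (M 0 0 : ℂ) = a at *
  generalize (M 0 1 : ℂ) = b at *
  generalize (M 1 0 : ℂ) = c at *
  generalize (M 1 1 : ℂ) = d at *
  generalize conj l = l₂ at *
  generalize conj u = u₂ at *
  set J : ℂ := c * τ + d with hJd
  have h1 : ε * (z₁ + ε⁻¹ * (a * l + c * u) * τ + ε⁻¹ * (b * l + d * u)) / J
      = ε * z₁ / J + l * ((a * τ + b) / J) + u := by
    field_simp
    rw [hJd]
    ring
  have h2 : ε⁻¹ * (z₂ + ε⁻¹⁻¹ * (a * l₂ + c * u₂) * τ + ε⁻¹⁻¹ * (b * l₂ + d * u₂)) / J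
      = ε⁻¹ * z₂ / J + l₂ * ((a * τ + b) / J) + u₂ := by
    field_simp
    rw [hJd]
    ring
  rw [h1, h2]
  -- Equality of the exponents on the two sides; this is where `det M = 1` enters.
  have h3 : -(m * c * z₁ * z₂ / J) + m * (l * l₂ * ((a * τ + b) / J) + l₂ * (ε * z₁ / J) +
      l * (ε⁻¹ * z₂ / J)) =
      m * (a * b * (l * l₂) + c * d * (u * u₂) + b * c * (l * u₂ + l₂ * u)) +
      (m * (ε⁻¹ * (a * l + c * u) * (ε⁻¹⁻¹ * (a * l₂ + c * u₂)) * τ +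
        ε⁻¹⁻¹ * (a * l₂ + c * u₂) * z₁ + ε⁻¹ * (a * l + c * u) * z₂) +
      -(m * c * (z₁ + ε⁻¹ * (a * l + c * u) * τ + ε⁻¹ * (b * l + d * u)) *
        (z₂ + ε⁻¹⁻¹ * (a * l₂ + c * u₂) * τ + ε⁻¹⁻¹ * (b * l₂ + d * u₂)) / J)) := by
    field_simp
    rw [hJd]
    linear_combination (-m * (ε * l * l₂ * (a * τ + b) + ε ^ 2 * l₂ * z₁ + l * z₂) : ℂ) * hdet
  have h4 := congrArg e h3
  rw [e_add, e_add, e_add] at h4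
  linear_combination (ε ^ (-k) * J ^ (-k) *
    f τ' (ε * z₁ / J + l * ((a * τ + b) / J) + u)
      (ε⁻¹ * z₂ / J + l₂ * ((a * τ + b) / J) + u₂)) * h4

/-- As `N(ρ) = m`, conjugation by `U_ρ` turns the index `m` action of `l` into the index one action
of `ρl`, so the multiples of `1/ρ` become integral. -/
theorem opA_opU {ρ : ℂ} (hρ : ρ * conj ρ = m) :
    opA m l (opU ρ f) = opU ρ (opA 1 (ρ * l) f) := by
  funext τ z₁ z₂
  simp only [opA, opU, LinearMap.coe_mk, AddHom.coe_mk, map_mul, ← hρ, Nat.cast_one]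
  ring_nf

theorem opB_opU (ρ : ℂ) : opB u (opU ρ f) = opU ρ (opB (ρ * u) f) := by
  funext τ z₁ z₂
  simp only [opB, opU, LinearMap.coe_mk, AddHom.coe_mk, map_mul]
  ring_nf

theorem opS_opU (k : ℤ) (ε : ℂ) (M : Matrix.SpecialLinearGroup (Fin 2) ℤ) {ρ : ℂ}
    (hρ : ρ * conj ρ = m) :
    opS k m ε M (opU ρ f) = opU ρ (opS k 1 ε M f) := by
  funext τ z₁ z₂
  simp only [opS, slashU, opU, LinearMap.coe_mk, AddHom.coe_mk, ← hρ, Nat.cast_one]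
  ring_nf

theorem opU_opU (ρ ρ' : ℂ) : opU ρ (opU ρ' f) = opU (ρ * ρ') f := by
  funext τ z₁ z₂
  simp only [opU, LinearMap.coe_mk, AddHom.coe_mk, map_mul]
  ring_nf

theorem opU_one : opU 1 f = f := by
  funext τ z₁ z₂
  simp [opU]

theorem opU_injective {ρ : ℂ} (hρ : ρ ≠ 0) : Function.Injective (opU ρ) := by
  intro f g h
  have := congrArg (opU ρ⁻¹) h
  rwa [opU_opU, opU_opU, inv_mul_cancel₀ hρ, opU_one, opU_one] at this

end Operators

/-! ### Stability of holomorphy under the operators. -/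

section Holomorphy

variable {f : UpperHalfPlane → ℂ → ℂ → ℂ}

theorem IsHolomorphic.comp (hf : IsHolomorphic f) {a b : ℂ × ℂ × ℂ → ℂ}
    (ha : Differentiable ℂ a) (hb : Differentiable ℂ b) :
    DifferentiableOn ℂ (fun w : ℂ × ℂ × ℂ => f (UpperHalfPlane.ofComplex w.1) (a w) (b w))
      {w : ℂ × ℂ × ℂ | 0 < w.1.im} :=
  DifferentiableOn.comp (f := fun w : ℂ × ℂ × ℂ => (w.1, a w, b w)) hf
    (differentiable_fst.prodMk (ha.prodMk hb)).differentiableOn (fun _ hw => hw)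

theorem IsHolomorphic.opA (hf : IsHolomorphic f) (m : ℕ) (l : ℂ) :
    IsHolomorphic (opA m l f) := by
  have h1 : Differentiable ℂ fun w : ℂ × ℂ × ℂ =>
      e (m * (l * conj l * w.1 + conj l * w.2.1 + l * w.2.2)) := by
    unfold e
    fun_prop
  have h2 := IsHolomorphic.comp hf (a := fun w => w.2.1 + l * w.1)
    (b := fun w => w.2.2 + conj l * w.1) (by fun_prop) (by fun_prop)
  refine (h1.differentiableOn.mul h2).congr fun w hw => ?_
  simp [HermitianJacobi.opA, UpperHalfPlane.ofComplex_apply_of_im_pos hw]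

theorem IsHolomorphic.opB (hf : IsHolomorphic f) (u : ℂ) : IsHolomorphic (opB u f) :=
  IsHolomorphic.comp hf (a := fun w => w.2.1 + u) (b := fun w => w.2.2 + conj u)
    (by fun_prop) (by fun_prop)

theorem IsHolomorphic.opU (hf : IsHolomorphic f) (ρ : ℂ) : IsHolomorphic (opU ρ f) :=
  IsHolomorphic.comp hf (a := fun w => ρ * w.2.1) (b := fun w => conj ρ * w.2.2)
    (by fun_prop) (by fun_prop)

theorem IsHolomorphic.sub {g : UpperHalfPlane → ℂ → ℂ → ℂ} (hf : IsHolomorphic f)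
    (hg : IsHolomorphic g) : IsHolomorphic (f - g) := DifferentiableOn.sub hf hg

theorem IsHolomorphic.smul (hf : IsHolomorphic f) (a : ℂ) : IsHolomorphic (a • f) :=
  DifferentiableOn.const_smul hf a

theorem IsHolomorphic.sum {ι : Type*} {s : Finset ι} {F : ι → UpperHalfPlane → ℂ → ℂ → ℂ}
    (hF : ∀ i ∈ s, IsHolomorphic (F i)) : IsHolomorphic (∑ i ∈ s, F i) := by
  have h := DifferentiableOn.sum (u := s) hF
  refine h.congr fun w _ => ?_
  simp

end Holomorphy

/-! ### Effect of the translations on Fourier coefficients. -/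

section Fourier

set_option linter.unusedSectionVars false

variable {K : Type*} [Field K] [NumberField K] {σ : K →+* ℂ} {m : ℕ}
  {f g : UpperHalfPlane → ℂ → ℂ → ℂ} {c d : ℕ → 𝓞 K → ℂ}

theorem HasFourierExpansion.zero : HasFourierExpansion σ m 0 0 :=
  ⟨fun _ _ h => absurd rfl h, fun _ _ _ => by simp⟩

theorem HasFourierExpansion.add (hf : HasFourierExpansion σ m f c)
    (hg : HasFourierExpansion σ m g d) : HasFourierExpansion σ m (f + g) (c + d) := by
  refine ⟨fun n r h => ?_, fun τ z₁ z₂ => ?_⟩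
  · by_cases hcz : c n r = 0
    · exact hg.1 n r fun hdz => h (by simp [hcz, hdz])
    · exact hf.1 n r hcz
  · simpa [add_mul] using (hf.2 τ z₁ z₂).add (hg.2 τ z₁ z₂)

theorem HasFourierExpansion.smul (hf : HasFourierExpansion σ m f c) (a : ℂ) :
    HasFourierExpansion σ m (a • f) (a • c) :=
  ⟨fun n r h => hf.1 n r fun hcz => h (by simp [hcz]), fun τ z₁ z₂ => by
    simpa [mul_assoc] using (hf.2 τ z₁ z₂).mul_left a⟩

theorem HasFourierExpansion.sub (hf : HasFourierExpansion σ m f c)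
    (hg : HasFourierExpansion σ m g d) : HasFourierExpansion σ m (f - g) (c - d) := by
  simpa [sub_eq_add_neg] using hf.add (hg.smul (-1))

theorem HasFourierExpansion.sum {ι : Type*} {s : Finset ι}
    {F : ι → UpperHalfPlane → ℂ → ℂ → ℂ} {C : ι → ℕ → 𝓞 K → ℂ}
    (hF : ∀ i ∈ s, HasFourierExpansion σ m (F i) (C i)) :
    HasFourierExpansion σ m (∑ i ∈ s, F i) (∑ i ∈ s, C i) := by
  classical
  induction s using Finset.induction_on with
  | empty => exact HasFourierExpansion.zero
  | insert i s his ih =>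
    rw [Finset.sum_insert his, Finset.sum_insert his]
    exact (hF i (Finset.mem_insert_self _ _)).add
      (ih fun j hj => hF j (Finset.mem_insert_of_mem hj))

theorem HasFourierExpansion.congr (hf : HasFourierExpansion σ m f c)
    (h : ∀ n r, c n r = d n r) : HasFourierExpansion σ m f d := by
  have : c = d := funext fun n => funext fun r => h n r
  rwa [← this]

theorem HasFourierExpansion.unique_fun (hf : HasFourierExpansion σ m f c)
    (hg : HasFourierExpansion σ m g c) : f = g := by
  funext τ z₁ z₂
  exact (hf.2 τ z₁ z₂).unique (hg.2 τ z₁ z₂)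

theorem fourier_exponent (r : 𝓞 K) :
    I * σ r / sqrtAbsDiscr K = -(σ r / (I * sqrtAbsDiscr K)) := by
  have h1 : (sqrtAbsDiscr K : ℂ) ≠ 0 := by exact_mod_cast (sqrtAbsDiscr_pos (K := K)).ne'
  field_simp
  rw [I_sq]
  ring

theorem conj_fourier_exponent (r : 𝓞 K) :
    conj (I * σ r / sqrtAbsDiscr K) = conj (σ r) / (I * sqrtAbsDiscr K) := by
  rw [fourier_exponent, map_neg, map_div₀, conj_I_mul_sqrtAbsDiscr, div_neg, neg_neg]

theorem HasFourierExpansion.opB (hf : HasFourierExpansion σ m f c) (u : ℂ) :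
    HasFourierExpansion σ m (opB u f) (fun n r => e (-trDiff K (σ r * u)) * c n r) := by
  refine ⟨fun n r h => hf.1 n r (right_ne_zero_of_mul h), fun τ z₁ z₂ => ?_⟩
  have h := hf.2 τ (z₁ + u) (z₂ + conj u)
  refine (congrArg (fun F => HasSum F _) ?_).mpr h
  funext q
  have h1 : I * σ q.2 / sqrtAbsDiscr K * u + conj (I * σ q.2 / sqrtAbsDiscr K) * conj u =
      -trDiff K (σ q.2 * u) := by
    rw [conj_fourier_exponent, fourier_exponent, trDiff, map_mul]
    ring
  simp only
  rw [← h1, mul_comm (e _), mul_assoc, ← e_add]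
  ring_nf

variable [Algebra.IsQuadraticExtension ℚ K] [IsTotallyComplex K]

/-- The quantity `|D|nm - N(r)` is invariant under the shift of `(n, r)` caused by `opA`, so the
support condition survives that operator. -/
theorem discriminant_shift (σ : K →+* ℂ) (m : ℕ) (n : ℤ) (r x : 𝓞 K) :
    ((discr K).natAbs : ℤ) * (n + m * nrm x + trDiffInt σ (r * x)) * m -
      nrm (r + (m : 𝓞 K) * sqrtDiscr σ * bar x) = (discr K).natAbs * n * m - nrm r := by
  have hS := I_mul_sqrtAbsDiscr_ne_zero (K := K)
  have hDS : (((discr K).natAbs : ℤ) : ℂ) = -(I * (sqrtAbsDiscr K : ℂ)) ^ 2 := by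
    rw [I_mul_sqrtAbsDiscr_sq, neg_neg, Int.cast_natCast]
  generalize ((discr K).natAbs : ℤ) = D at *
  have h : ((D * (n + m * nrm x + trDiffInt σ (r * x)) * m -
      nrm (r + (m : 𝓞 K) * sqrtDiscr σ * bar x) : ℤ) : ℂ) =
      ((D * n * m - nrm r : ℤ) : ℂ) := by
    push_cast
    rw [← trDiffInt_spec, nrm_eq σ, nrm_eq σ, nrm_eq σ, trDiff]
    simp only [map_add, map_mul, map_natCast, map_bar, conj_conj, sqrtDiscr_spec]
    rw [← map_mul conj I, conj_I_mul_sqrtAbsDiscr]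
    rw [hDS]
    generalize I * (sqrtAbsDiscr K : ℂ) = S at *
    field_simp
    ring
  exact_mod_cast h

/-- The extension of Fourier coefficients by zero to all integers `n`. -/
noncomputable def extZ (c : ℕ → 𝓞 K → ℂ) (n : ℤ) (r : 𝓞 K) : ℂ :=
  if 0 ≤ n then c n.toNat r else 0

theorem hasSum_extZ_iff (c : ℕ → 𝓞 K → ℂ) (E : ℤ → 𝓞 K → ℂ) (s : ℂ) :
    HasSum (fun q : ℕ × 𝓞 K => c q.1 q.2 * E q.1 q.2) s ↔
      HasSum (fun q : ℤ × 𝓞 K => extZ c q.1 q.2 * E q.1 q.2) s := by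
  have hinj : Function.Injective (Prod.map (Nat.cast : ℕ → ℤ) (id : 𝓞 K → 𝓞 K)) :=
    Nat.cast_injective.prodMap Function.injective_id
  rw [← hinj.hasSum_iff]
  · simp [Function.comp_def, extZ]
  · rintro ⟨n, r⟩ h
    have : ¬ 0 ≤ n := fun hn => h ⟨(n.toNat, r), by simp [hn]⟩
    simp [extZ, this]

/-- The bijection of the pairs `(n, r)` which `opA` induces on Fourier coefficients. -/
noncomputable def shiftEquiv (σ : K →+* ℂ) (m : ℕ) (x : 𝓞 K) : ℤ × 𝓞 K ≃ ℤ × 𝓞 K where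
  toFun q := (q.1 + m * nrm x + trDiffInt σ (q.2 * x), q.2 + m * sqrtDiscr σ * bar x)
  invFun q := (q.1 - m * nrm x - trDiffInt σ ((q.2 - m * sqrtDiscr σ * bar x) * x),
    q.2 - m * sqrtDiscr σ * bar x)
  left_inv q := by
    refine Prod.ext ?_ (by simp)
    simp only [add_sub_cancel_right]
    ring
  right_inv q := by
    refine Prod.ext ?_ (by simp)
    simp only
    ring

theorem HasFourierExpansion.opA (hm : 0 < m) (hf : HasFourierExpansion σ m f c) (x : 𝓞 K) :
    HasFourierExpansion σ m (opA m (σ x) f) (fun n r =>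
      extZ c (n + m * nrm x + trDiffInt σ (r * x)) (r + m * sqrtDiscr σ * bar x)) := by
  -- Stated for all integers `n`: a nonzero coefficient with `n < 0` would give `N(r) < 0`, so the
  -- shifted expansion again starts at `n = 0`.
  have key : ∀ (n : ℤ) (r : 𝓞 K),
      extZ c (n + m * nrm x + trDiffInt σ (r * x)) (r + m * sqrtDiscr σ * bar x) ≠ 0 →
      (nrm r : ℤ) ≤ (discr K).natAbs * n * m := by
    intro n r h
    have hd := discriminant_shift σ m n r x
    generalize n + m * nrm x + trDiffInt σ (r * x) = n' at *
    generalize r + (m : 𝓞 K) * sqrtDiscr σ * bar x = r' at *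
    rw [extZ] at h
    split_ifs at h with hn
    · have h1 := hf.1 _ _ h
      zify at h1
      rw [Int.toNat_of_nonneg hn] at h1
      push_cast at hd ⊢
      linarith
    · exact absurd rfl h
  have hD : 0 < ((discr K).natAbs : ℤ) := by
    exact_mod_cast Int.natAbs_pos.mpr (discr_ne_zero K)
  have hm' : (0 : ℤ) < m := by exact_mod_cast hm
  refine ⟨fun n r h => by exact_mod_cast key n r h, fun τ z₁ z₂ => ?_⟩
  have h1 := hf.2 τ (z₁ + σ x * τ) (z₂ + conj (σ x) * τ)
  have h2 := (hasSum_extZ_iff c (fun n r => e (n * τ + I * σ r / sqrtAbsDiscr K *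
    (z₁ + σ x * τ) + conj (I * σ r / sqrtAbsDiscr K) * (z₂ + conj (σ x) * τ))) _).mp
      (by simpa using h1)
  have h3 := ((shiftEquiv σ m x).hasSum_iff.mpr h2).mul_left
    (e (m * (σ x * conj (σ x) * τ + conj (σ x) * z₁ + σ x * z₂)))
  have h4 := (hasSum_extZ_iff (fun (n : ℕ) (r : 𝓞 K) =>
      extZ c (n + m * nrm x + trDiffInt σ (r * x)) (r + (m : 𝓞 K) * sqrtDiscr σ * bar x))
      (fun n r => e (n * τ + I * σ r / sqrtAbsDiscr K * z₁ +
        conj (I * σ r / sqrtAbsDiscr K) * z₂))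
      (HermitianJacobi.opA m (σ x) f τ z₁ z₂)).mpr ?_
  · simpa using h4
  · refine (congrArg (fun F => HasSum F _) ?_).mpr h3
    funext ⟨n, r⟩
    simp only [Function.comp_apply, shiftEquiv, Equiv.coe_fn_mk]
    have h5 : extZ (fun (n : ℕ) (r : 𝓞 K) => extZ c (n + m * nrm x + trDiffInt σ (r * x))
        (r + (m : 𝓞 K) * sqrtDiscr σ * bar x)) n r =
        extZ c (n + m * nrm x + trDiffInt σ (r * x))
          (r + (m : 𝓞 K) * sqrtDiscr σ * bar x) := by
      by_cases hn : 0 ≤ n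
      · conv_lhs => rw [extZ, if_pos hn]
        rw [Int.toNat_of_nonneg hn]
      · conv_lhs => rw [extZ, if_neg hn]
        by_contra h0
        have h6 := key n r (Ne.symm h0)
        have h7 : (discr K).natAbs * n * m < (0 : ℤ) := by
          have : ((discr K).natAbs : ℤ) * m * n < 0 :=
            mul_neg_of_pos_of_neg (mul_pos hD hm') (not_le.mp hn)
          linarith
        have : (0 : ℤ) ≤ nrm r := Int.natCast_nonneg _
        linarith
    rw [h5, mul_left_comm, ← e_add]
    congr 2
    have hS := I_mul_sqrtAbsDiscr_ne_zero (K := K)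
    rw [conj_fourier_exponent, fourier_exponent, conj_fourier_exponent, fourier_exponent]
    push_cast
    rw [← trDiffInt_spec, trDiff, nrm_eq σ]
    simp only [map_add, map_mul, map_natCast, map_bar, conj_conj, sqrtDiscr_spec]
    rw [← map_mul conj I, conj_I_mul_sqrtAbsDiscr]
    generalize I * (sqrtAbsDiscr K : ℂ) = S at *
    field_simp
    ring

end Fourier

/-! ### Indicator functions on `𝓞 K` as combinations of additive characters. -/

section Multipliers

set_option linter.unusedSectionVars false

theorem sum_e_eq (n : ℕ) (hn : 0 < n) (t : ℂ) (ht : ∃ k : ℤ, n * t = k) [Decidable (∃ k : ℤ, t = k)] :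
    (1 / n : ℂ) * ∑ i ∈ Finset.range n, e (-(i * t)) = if ∃ k : ℤ, t = k then 1 else 0 := by
  have hn' : (n : ℂ) ≠ 0 := by exact_mod_cast hn.ne'
  have h1 : ∀ i : ℕ, e (-(i * t)) = e (-t) ^ i := fun i => by
    rw [← e_natCast_mul, mul_neg]
  simp only [h1]
  split_ifs with h
  · obtain ⟨k, rfl⟩ := h
    rw [e_neg, e_intCast]
    simp [hn']
  · have h2 : e (-t) ≠ 1 := by
      rw [e_neg, ne_eq, inv_eq_one, e_eq_one_iff]
      exact h
    have h3 : e (-t) ^ n = 1 := by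
      rw [← h1, e_neg, (e_eq_one_iff _).mpr ht, inv_one]
    rw [geom_sum_eq h2, h3]
    simp

variable {K : Type*} [Field K] [NumberField K]

theorem trDiff_natCast_mul (n : ℕ) (w : ℂ) : trDiff K (n * w) = n * trDiff K w := by
  simp only [trDiff, map_mul, map_natCast]
  ring

/-- The span of the additive characters `r ↦ e(-tr(ra / (i√|D| κ)))` of `𝓞 K / κ`. -/
noncomputable def charSpan (σ : K →+* ℂ) (κ : 𝓞 K) : Submodule ℂ (𝓞 K → ℂ) :=
  Submodule.span ℂ (Set.range fun a : 𝓞 K => fun r : 𝓞 K => e (-trDiff K (σ r * (σ a / σ κ))))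

variable {σ : K →+* ℂ} {κ : 𝓞 K}

theorem char_mem_charSpan (a : 𝓞 K) :
    (fun r : 𝓞 K => e (-trDiff K (σ r * (σ a / σ κ)))) ∈ charSpan σ κ :=
  Submodule.subset_span ⟨a, rfl⟩

theorem one_mem_charSpan : (1 : 𝓞 K → ℂ) ∈ charSpan σ κ := by
  have h := char_mem_charSpan (σ := σ) (κ := κ) 0
  convert h using 1
  funext r
  simp [trDiff, e_zero]

theorem mul_mem_charSpan {g h : 𝓞 K → ℂ} (hg : g ∈ charSpan σ κ) (hh : h ∈ charSpan σ κ) :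
    g * h ∈ charSpan σ κ := by
  have h1 : g * h ∈ charSpan σ κ * charSpan σ κ := Submodule.mul_mem_mul hg hh
  refine (?_ : charSpan σ κ * charSpan σ κ ≤ charSpan σ κ) h1
  rw [charSpan, Submodule.span_mul_span]
  refine Submodule.span_mono ?_
  rintro _ ⟨_, ⟨a, rfl⟩, _, ⟨b, rfl⟩, rfl⟩
  refine ⟨a + b, ?_⟩
  funext r
  simp only [Pi.mul_apply]
  rw [← e_add, ← neg_add, ← trDiff_add, emb_add]
  ring_nf

theorem charSpan_mono {κ' : 𝓞 K} (h : κ ∣ κ') (h0 : κ' ≠ 0) : charSpan σ κ ≤ charSpan σ κ' := by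
  obtain ⟨b, rfl⟩ := h
  refine Submodule.span_le.mpr ?_
  rintro _ ⟨a, rfl⟩
  have hb : σ b ≠ 0 := fun h => h0 (by rw [(emb_eq_zero σ).mp h, mul_zero])
  have h := char_mem_charSpan (σ := σ) (κ := κ * b) (a * b)
  simp only [emb_mul] at h
  refine SetLike.mem_coe.mpr ?_
  simpa only [mul_div_mul_right _ _ hb] using h

variable [Algebra.IsQuadraticExtension ℚ K] [IsTotallyComplex K]

theorem nrm_pos (h : κ ≠ 0) : 0 < nrm κ := by
  rw [nrm, Int.natAbs_pos]
  exact Algebra.norm_ne_zero_iff.mpr h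

theorem exists_trDiff_eq_of_dvd {r : 𝓞 K} (h0 : κ ≠ 0) (h : κ ∣ r) (a : 𝓞 K) :
    ∃ n : ℤ, trDiff K (σ r * (σ a / σ κ)) = n := by
  obtain ⟨s, rfl⟩ := h
  obtain ⟨n, hn⟩ := exists_trDiff_eq σ (s * a)
  refine ⟨n, ?_⟩
  have : σ κ ≠ 0 := fun h => h0 ((emb_eq_zero σ).mp h)
  rw [← hn, emb_mul, emb_mul]
  congr 1
  field_simp

theorem exists_nrm_mul_trDiff_eq (h0 : κ ≠ 0) (r a : 𝓞 K) :
    ∃ n : ℤ, nrm κ * trDiff K (σ r * (σ a / σ κ)) = n := by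
  obtain ⟨n, hn⟩ := exists_trDiff_eq σ (r * a * bar κ)
  refine ⟨n, ?_⟩
  have : σ κ ≠ 0 := fun h => h0 ((emb_eq_zero σ).mp h)
  rw [← hn, ← trDiff_natCast_mul, nrm_eq σ, emb_mul, emb_mul, map_bar]
  congr 1
  field_simp

-- By self-duality, `κ ∣ r` means that `tr(r b/(κδ))` is an integer for both elements `b` of a
-- basis. Each of the two conditions is detected by a geometric sum of `N(κ)` characters, and
-- characters multiply.
open Classical in
theorem dvd_indicator_mem_charSpan (h0 : κ ≠ 0) :
    (fun r : 𝓞 K => if κ ∣ r then (1 : ℂ) else 0) ∈ charSpan σ κ := by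
  obtain ⟨b₀, b₁, -, hd⟩ := exists_basis σ
  have h1 : ∀ b : 𝓞 K, (fun r : 𝓞 K =>
      if ∃ k : ℤ, trDiff K (σ r * (σ b / σ κ)) = k then (1 : ℂ) else 0) ∈ charSpan σ κ := by
    intro b
    have h2 : (1 / nrm κ : ℂ) • ∑ i ∈ Finset.range (nrm κ),
        (fun r : 𝓞 K => e (-trDiff K (σ r * (σ ((i : 𝓞 K) * b : 𝓞 K) / σ κ)))) ∈ charSpan σ κ :=
      Submodule.smul_mem _ _ (Submodule.sum_mem _ fun i _ => char_mem_charSpan _)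
    convert h2 using 1
    funext r
    rw [← sum_e_eq (nrm κ) (nrm_pos h0) _ (exists_nrm_mul_trDiff_eq h0 r b)]
    simp only [Pi.smul_apply, Finset.sum_apply, smul_eq_mul]
    congr 1
    refine Finset.sum_congr rfl fun i _ => ?_
    rw [← trDiff_natCast_mul, emb_mul, emb_natCast]
    ring_nf
  convert mul_mem_charSpan (h1 b₀) (h1 b₁) using 1
  funext r
  have hκ : σ κ ≠ 0 := fun h => h0 ((emb_eq_zero σ).mp h)
  by_cases h : κ ∣ r
  · simp [h, exists_trDiff_eq_of_dvd h0 h]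
  · by_cases h2 : ∃ k : ℤ, trDiff K (σ r * (σ b₀ / σ κ)) = k
    · by_cases h3 : ∃ k : ℤ, trDiff K (σ r * (σ b₁ / σ κ)) = k
      · exfalso
        obtain ⟨s, hs⟩ := exists_eq_of_trDiff σ b₀ b₁ hd (σ r / σ κ)
          (by rwa [div_mul_eq_mul_div, mul_div_assoc]) (by rwa [div_mul_eq_mul_div, mul_div_assoc])
        refine h ⟨s, ?_⟩
        rw [← emb_inj σ, emb_mul, ← hs]
        field_simp
      · simp only [Pi.mul_apply, if_neg h, if_neg h3, mul_zero]
    · simp only [Pi.mul_apply, if_neg h, if_neg h2, zero_mul]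

-- Inclusion-exclusion over primes: coprimality to `wa` is the product of `1 - 1_{w ∣ r}` with
-- coprimality to `a`.
open Classical in
theorem coprime_indicator_mem_charSpan [IsPrincipalIdealRing (𝓞 K)] (h0 : κ ≠ 0) :
    (fun r : 𝓞 K => if IsCoprime r κ then (1 : ℂ) else 0) ∈ charSpan σ κ := by
  induction κ using UniqueFactorizationMonoid.induction_on_prime with
  | h₁ => exact absurd rfl h0
  | h₂ u hu =>
    obtain ⟨v, hv⟩ := hu.exists_left_inv
    have : ∀ r : 𝓞 K, IsCoprime r u := fun r => ⟨0, v, by simp [hv]⟩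
    simp only [this, if_true]
    exact one_mem_charSpan
  | h₃ a w ha hw ih =>
    have h1 := charSpan_mono (σ := σ) (dvd_mul_left a w) h0 (ih ha)
    have h2 := charSpan_mono (σ := σ) (dvd_mul_right w a) h0 (dvd_indicator_mem_charSpan hw.ne_zero)
    convert mul_mem_charSpan (Submodule.sub_mem _ one_mem_charSpan h2) h1 using 1
    funext r
    have h3 : IsCoprime r w ↔ ¬ w ∣ r := by
      rw [isCoprime_comm]
      exact hw.irreducible.coprime_iff_not_dvd
    simp only [IsCoprime.mul_right_iff, h3, Pi.mul_apply, Pi.sub_apply, Pi.one_apply]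
    by_cases h4 : w ∣ r <;> simp [h4]

/-- Multiplying the Fourier coefficients by a combination of characters amounts to applying
the same combination of translations. -/
theorem exists_multiplier {g : 𝓞 K → ℂ} (hg : g ∈ charSpan σ κ) :
    ∃ P ∈ Submodule.span ℂ (Set.range fun a : 𝓞 K => opB (σ a / σ κ)),
      ∀ m f c, HasFourierExpansion σ m f c →
        HasFourierExpansion σ m (P f) (fun n r => g r * c n r) := by
  induction hg using Submodule.span_induction with
  | mem g hg =>
    obtain ⟨a, rfl⟩ := hg
    exact ⟨_, Submodule.subset_span ⟨a, rfl⟩, fun m f c h => h.opB _⟩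
  | zero =>
    refine ⟨0, Submodule.zero_mem _, fun m f c h => ?_⟩
    exact (HasFourierExpansion.zero (σ := σ) (m := m)).congr (by simp)
  | add g g' _ _ h h' =>
    obtain ⟨P, hP, hP'⟩ := h
    obtain ⟨Q, hQ, hQ'⟩ := h'
    refine ⟨P + Q, Submodule.add_mem _ hP hQ, fun m f c h => ?_⟩
    exact ((hP' m f c h).add (hQ' m f c h)).congr (by simp [add_mul])
  | smul a g _ h =>
    obtain ⟨P, hP, hP'⟩ := h
    refine ⟨a • P, Submodule.smul_mem _ _ hP, fun m f c h => ?_⟩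
    exact ((hP' m f c h).smul a).congr (by simp [mul_assoc])

end Multipliers

/-! ### Removing the primes of the different. -/

section Reduction

/-- The matrix with rows `(1, 0)` and `(n, 1)`. -/
def lowerUnipotent (n : ℤ) : Matrix.SpecialLinearGroup (Fin 2) ℤ :=
  ⟨!![1, 0; n, 1], by simp [Matrix.det_fin_two]⟩

/-- The matrix with rows `(1, n)` and `(0, 1)`. -/
def upperUnipotent (n : ℤ) : Matrix.SpecialLinearGroup (Fin 2) ℤ :=
  ⟨!![1, n; 0, 1], by simp [Matrix.det_fin_two]⟩

theorem opS_lower_opB (k : ℤ) (m : ℕ) (n : ℤ) (u : ℂ) (f : UpperHalfPlane → ℂ → ℂ → ℂ) :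
    opS k m 1 (lowerUnipotent n) (opB u f) =
      e (m * (n * (u * conj u))) • opA m (n * u) (opB u (opS k m 1 (lowerUnipotent n) f)) := by
  have h := opS_opA_opB f m 0 u k (ε := 1) (by simp) (lowerUnipotent n)
  simpa [lowerUnipotent, opA_zero] using h

theorem opS_upper_opB (k : ℤ) (m : ℕ) (n : ℤ) (u : ℂ) (f : UpperHalfPlane → ℂ → ℂ → ℂ) :
    opS k m 1 (upperUnipotent n) (opB u f) = opB u (opS k m 1 (upperUnipotent n) f) := by
  have h := opS_opA_opB f m 0 u k (ε := 1) (by simp) (upperUnipotent n)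
  simpa [upperUnipotent, opA_zero, e_zero] using h

theorem opS_upper_opA (k : ℤ) (m : ℕ) (n : ℤ) (l : ℂ) (f : UpperHalfPlane → ℂ → ℂ → ℂ) :
    opS k m 1 (upperUnipotent n) (opA m l f) =
      e (m * (n * (l * conj l))) • opA m l (opB (n * l) (opS k m 1 (upperUnipotent n) f)) := by
  have h := opS_opA_opB f m l 0 k (ε := 1) (by simp) (upperUnipotent n)
  simpa [upperUnipotent, opB_zero] using h

/-- A function that is fixed by two opposite unipotent matrices of level `n` and by the
translation by `u` vanishes, unless `m n³ |u|²` is an integer. -/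
theorem eq_zero_of_unipotent_of_opB {k : ℤ} {m : ℕ} {n : ℤ} {u : ℂ}
    {f : UpperHalfPlane → ℂ → ℂ → ℂ} (hL : opS k m 1 (lowerUnipotent n) f = f)
    (hT : opS k m 1 (upperUnipotent n) f = f) (hu : opB u f = f)
    (hu' : opB (n * (n * u)) f = f)
    (hm : ∀ t : ℤ, (m : ℂ) * n ^ 3 * (u * conj u) ≠ t) : f = 0 := by
  have h1 := opS_lower_opB k m n u f
  rw [hu, hL, hu] at h1
  set E := e (m * (n * (u * conj u)))
  -- Here `f = E • opA m (n u) f`. The upper unipotent matrix reproduces this equation with an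
  -- additional factor `E' = e(m n³ |u|²)`, whence `f = E' • f`.
  have h2 := congrArg (opS k m 1 (upperUnipotent n)) h1
  rw [map_smul, opS_upper_opA, hT, hu', smul_comm, ← h1] at h2
  set E' := e (m * (n * (n * u * conj (n * u)))) with hE'
  have h3 : E' ≠ 1 := by
    rw [hE', ne_eq, e_eq_one_iff]
    rintro ⟨t, ht⟩
    refine hm t ?_
    rw [← ht, map_mul, map_intCast]
    ring
  have h4 : (E' - 1) • f = 0 := by
    rw [sub_smul, one_smul, ← h2, sub_self]
  exact (smul_eq_zero.mp h4).resolve_left (sub_ne_zero.mpr h3)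

variable {K : Type*} [Field K] [NumberField K]
variable [Algebra.IsQuadraticExtension ℚ K] [IsTotallyComplex K] {σ : K →+* ℂ}
  {k : ℤ} {p : ℕ} {φ : UpperHalfPlane → ℂ → ℂ → ℂ}

/-- With `n = N(η)²` and `u = a/η` the vector `nu` is integral, and both `p n |u|²` and the exponent
of the commutator are integers. The correction term in `opS_lower_opB` therefore disappears. -/
theorem opS_span_eq {η : 𝓞 K} (h0 : η ≠ 0)
    (hU : ∀ M : Matrix.SpecialLinearGroup (Fin 2) ℤ, opS k p 1 M φ = φ)
    (hA : ∀ l : 𝓞 K, opA p (σ l) φ = φ)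
    {P : (UpperHalfPlane → ℂ → ℂ → ℂ) →ₗ[ℂ] (UpperHalfPlane → ℂ → ℂ → ℂ)}
    (hP : P ∈ Submodule.span ℂ (Set.range fun a : 𝓞 K => opB (σ a / σ η))) :
    opS k p 1 (lowerUnipotent ((nrm η) ^ 2 : ℕ)) (P φ) = P φ ∧
      opS k p 1 (upperUnipotent ((nrm η) ^ 2 : ℕ)) (P φ) = P φ := by
  have hη : σ η ≠ 0 := fun h => h0 ((emb_eq_zero σ).mp h)
  have hη' : conj (σ η) ≠ 0 := (map_ne_zero _).mpr hη
  induction hP using Submodule.span_induction with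
  | mem P hP =>
    obtain ⟨a, rfl⟩ := hP
    refine ⟨?_, by simp only [opS_upper_opB, hU]⟩
    simp only [opS_lower_opB, hU]
    have h1 : (((nrm η ^ 2 : ℕ) : ℤ) : ℂ) * (σ a / σ η) = σ (η * bar η * bar η * a : 𝓞 K) := by
      simp only [emb_mul, map_bar]
      push_cast
      rw [nrm_eq σ]
      field_simp
    have h2 : e (p * ((((nrm η ^ 2 : ℕ) : ℤ) : ℂ) * (σ a / σ η * conj (σ a / σ η)))) = 1 := by
      rw [e_eq_one_iff]
      refine ⟨(p * (nrm η * nrm a) : ℕ), ?_⟩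
      push_cast
      rw [nrm_eq σ, nrm_eq σ, map_div₀]
      field_simp
    have h3 := opB_opA φ p (σ (η * bar η * bar η * a : 𝓞 K)) (σ a / σ η)
    have h4 : e (p * (σ (η * bar η * bar η * a : 𝓞 K) * conj (σ a / σ η) +
        conj (σ (η * bar η * bar η * a : 𝓞 K)) * (σ a / σ η))) = 1 := by
      rw [e_eq_one_iff]
      refine ⟨(p * (2 * (nrm η * nrm a)) : ℕ), ?_⟩
      push_cast
      rw [nrm_eq σ, nrm_eq σ, map_div₀]
      simp only [map_bar, map_mul, conj_conj]
      field_simp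
      ring
    rw [hA, h4, one_smul] at h3
    rw [h1, h2, one_smul, ← h3]
  | zero => simp
  | add P Q _ _ hP hQ =>
    simp only [LinearMap.add_apply, map_add]
    rw [hP.1, hP.2, hQ.1, hQ.2]
    exact ⟨rfl, rfl⟩
  | smul a P _ hP =>
    simp only [LinearMap.smul_apply, map_smul]
    rw [hP.1, hP.2]
    exact ⟨rfl, rfl⟩

/-- The part of `φ` on the `r` coprime to `η` lives on multiples of `w`, hence is fixed by
translation by `1/w` as well as by the unipotent matrices of level `N(η)²`. It vanishes because `p
N(η)⁶/N(w)` is not an integer. -/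
theorem exists_expansion_of_vanish_step [IsPrincipalIdealRing (𝓞 K)] {η w : 𝓞 K} (h0 : η ≠ 0)
    (hpη : (p : 𝓞 K) ∣ η) (hw : Prime w) (hwη : ¬ w ∣ η) (hww : w ∣ bar w)
    (hU : ∀ M : Matrix.SpecialLinearGroup (Fin 2) ℤ, opS k p 1 M φ = φ)
    (hA : ∀ l : 𝓞 K, opA p (σ l) φ = φ) {c : ℕ → 𝓞 K → ℂ}
    (hF : HasFourierExpansion σ p φ c) (hc : ∀ n r, IsCoprime r (w * η) → c n r = 0) :
    ∃ c', HasFourierExpansion σ p φ c' ∧ ∀ n r, IsCoprime r η → c' n r = 0 := by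
  classical
  have hw0 : σ w ≠ 0 := fun h => hw.ne_zero ((emb_eq_zero σ).mp h)
  have hw0' : conj (σ w) ≠ 0 := (map_ne_zero _).mpr hw0
  obtain ⟨P, hP, hP'⟩ := exists_multiplier (coprime_indicator_mem_charSpan (σ := σ) h0)
  have hψ := hP' p φ c hF
  obtain ⟨hL, hT⟩ := opS_span_eq h0 hU hA hP
  have hB : ∀ a : 𝓞 K, opB (σ a / σ w) (P φ) = P φ := by
    intro a
    refine ((hψ.opB (σ a / σ w)).congr fun n r => ?_).unique_fun hψ
    by_cases h1 : IsCoprime r η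
    · by_cases h2 : w ∣ r
      · obtain ⟨t, ht⟩ := exists_trDiff_eq_of_dvd (σ := σ) hw.ne_zero h2 a
        rw [ht, e_neg, e_intCast, inv_one, one_mul]
      · have h3 : IsCoprime r w := isCoprime_comm.mp (hw.irreducible.coprime_iff_not_dvd.mpr h2)
        rw [hc n r (h3.mul_right h1), mul_zero, mul_zero]
    · simp [h1]
  have hzero : P φ = 0 := by
    refine eq_zero_of_unipotent_of_opB hL hT (u := 1 / σ w) ?_ ?_ ?_
    · simpa using hB 1
    · convert hB ((((nrm η ^ 2 : ℕ) : 𝓞 K)) ^ 2) using 2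
      simp only [pow_two, emb_mul, emb_natCast]
      push_cast
      ring_nf
    · intro t ht
      have h1 : (p : 𝓞 K) * (nrm η : 𝓞 K) ^ 6 = t * (w * bar w) := by
        rw [← emb_inj σ]
        simp only [emb_mul, emb_natCast, map_bar, emb_intCast]
        rw [map_div₀, map_one] at ht
        push_cast at ht
        rw [← ht]
        have : σ (((nrm η : 𝓞 K) ^ 6 : 𝓞 K) : K) = (nrm η : ℂ) ^ 6 := by simp
        rw [this]
        field_simp
      have h2 : w ∣ (p : 𝓞 K) * (nrm η : 𝓞 K) ^ 6 :=
        h1 ▸ (dvd_mul_right w _).mul_left _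
      rcases hw.dvd_or_dvd h2 with h | h
      · exact hwη (h.trans hpη)
      · have h3 := hw.dvd_of_dvd_pow h
        rw [natCast_nrm] at h3
        rcases hw.dvd_or_dvd h3 with h | h
        · exact hwη h
        · exact hwη (hww.trans (by simpa using bar_dvd h))
  -- Subtracting an expansion of the zero function gives the new coefficients, so uniqueness of
  -- Fourier expansions is not needed.
  have hsub := hF.sub hψ
  rw [hzero, sub_zero] at hsub
  refine ⟨_, hsub, fun n r h => ?_⟩
  simp [h]

theorem exists_expansion_of_vanish [IsPrincipalIdealRing (𝓞 K)] (hp0 : p ≠ 0)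
    (hp : ∀ w : 𝓞 K, Prime w → w ∣ sqrtDiscr σ → ¬ w ∣ (p : 𝓞 K))
    (hU : ∀ M : Matrix.SpecialLinearGroup (Fin 2) ℤ, opS k p 1 M φ = φ)
    (hA : ∀ l : 𝓞 K, opA p (σ l) φ = φ) {c : ℕ → 𝓞 K → ℂ}
    (hF : HasFourierExpansion σ p φ c)
    (hc : ∀ n r, IsCoprime r (sqrtDiscr σ * p) → c n r = 0) :
    ∃ c', HasFourierExpansion σ p φ c' ∧ ∀ n r, IsCoprime r (p : 𝓞 K) → c' n r = 0 := by
  have hδ : sqrtDiscr σ ≠ 0 := by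
    intro h
    have := sqrtDiscr_spec σ
    rw [h] at this
    exact I_mul_sqrtAbsDiscr_ne_zero (K := K) (by simpa using this.symm)
  have hp0' : (p : 𝓞 K) ≠ 0 := by exact_mod_cast hp0
  have key : ∀ a : 𝓞 K, a ∣ sqrtDiscr σ → ∀ c : ℕ → 𝓞 K → ℂ, HasFourierExpansion σ p φ c →
      (∀ n r, IsCoprime r (a * p) → c n r = 0) →
      ∃ c', HasFourierExpansion σ p φ c' ∧ ∀ n r, IsCoprime r (p : 𝓞 K) → c' n r = 0 := by
    intro a
    induction a using UniqueFactorizationMonoid.induction_on_prime with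
    | h₁ => exact fun h => absurd (zero_dvd_iff.mp h) hδ
    | h₂ u hu =>
      intro _ c hF hc
      obtain ⟨v, hv⟩ := hu.exists_left_inv
      refine ⟨c, hF, fun n r h => hc n r (IsCoprime.mul_right ⟨0, v, by simp [hv]⟩ h)⟩
    | h₃ a w ha hw ih =>
      intro hd c hF hc
      have hda : a ∣ sqrtDiscr σ := (dvd_mul_left a w).trans hd
      have hdw : w ∣ sqrtDiscr σ := (dvd_mul_right w a).trans hd
      -- A repeated prime factor does not change the coprimality condition.
      by_cases hwa : w ∣ a
      · refine ih hda c hF fun n r h => hc n r ?_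
        have h1 := (IsCoprime.mul_right_iff.mp h).1
        rw [mul_assoc]
        exact IsCoprime.mul_right (h1.of_isCoprime_of_dvd_right hwa) h
      · obtain ⟨c', hF', hc'⟩ := exists_expansion_of_vanish_step (η := a * (p : 𝓞 K)) (w := w)
          (mul_ne_zero ha hp0') (dvd_mul_left _ _) hw
          (fun h => (hw.dvd_or_dvd h).elim hwa (hp w hw hdw))
          (dvd_bar_of_dvd_sqrtDiscr σ hdw dvd_rfl) hU hA hF
          (fun n r h => hc n r (by rwa [mul_assoc]))
        exact ih hda c' hF' hc'
  exact key _ dvd_rfl c hF hc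

end Reduction

/-! ### Residues and characters modulo a split prime. -/

section SplitPrime

set_option linter.unusedSectionVars false

variable {K : Type*} [Field K] [NumberField K]
variable [Algebra.IsQuadraticExtension ℚ K] [IsTotallyComplex K] {σ : K →+* ℂ}
  {k : ℤ} {p : ℕ} {ρ : 𝓞 K}

/-- `ρ` is a prime of degree one over the split rational prime `p`, prime to the different. -/
structure IsSplitPrime (σ : K →+* ℂ) (p : ℕ) (ρ : 𝓞 K) : Prop where
  prime_nat : p.Prime
  prime : Prime ρ
  mul_bar : ρ * bar ρ = p
  not_dvd_bar : ¬ ρ ∣ bar ρ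
  not_dvd_sqrtDiscr : ¬ ρ ∣ sqrtDiscr σ

namespace IsSplitPrime

theorem conj_prime (h : IsSplitPrime σ p ρ) : IsSplitPrime σ p (bar ρ) where
  prime_nat := h.prime_nat
  prime := bar_prime h.prime
  mul_bar := by rw [bar_bar, mul_comm, h.mul_bar]
  not_dvd_bar := fun h' => h.not_dvd_bar (by simpa using bar_dvd h')
  not_dvd_sqrtDiscr := fun h' => h.not_dvd_sqrtDiscr (by
    simpa [bar_sqrtDiscr] using bar_dvd h')

theorem emb_ne_zero (h : IsSplitPrime σ p ρ) : σ ρ ≠ 0 :=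
  fun h' => h.prime.ne_zero ((emb_eq_zero σ).mp h')

theorem conj_emb_ne_zero (h : IsSplitPrime σ p ρ) : conj (σ ρ) ≠ 0 :=
  (map_ne_zero _).mpr h.emb_ne_zero

theorem emb_mul_conj (h : IsSplitPrime σ p ρ) : σ ρ * conj (σ ρ) = p := by
  rw [← map_bar, ← emb_mul, h.mul_bar, emb_natCast]

theorem dvd_natCast (h : IsSplitPrime σ p ρ) : ρ ∣ (p : 𝓞 K) := h.mul_bar ▸ dvd_mul_right _ _

theorem natCast_ne_zero (h : IsSplitPrime σ p ρ) : (p : ℂ) ≠ 0 := by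
  exact_mod_cast h.prime_nat.ne_zero

theorem dvd_intCast_iff (h : IsSplitPrime σ p ρ) (n : ℤ) : ρ ∣ (n : 𝓞 K) ↔ (p : ℤ) ∣ n := by
  refine ⟨fun hn => ?_, fun hn => ?_⟩
  · by_contra hpn
    have h1 : IsCoprime (p : ℤ) n :=
      (Nat.prime_iff_prime_int.mp h.prime_nat).irreducible.coprime_iff_not_dvd.mpr hpn
    obtain ⟨s, t, hst⟩ := h1
    refine h.prime.not_isUnit (isUnit_of_dvd_one ?_)
    have h2 : (1 : 𝓞 K) = s * p + t * n := by exact_mod_cast congrArg (Int.cast (R := 𝓞 K)) hst.symm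
    rw [h2]
    exact dvd_add (h.dvd_natCast.mul_left _) (hn.mul_left _)
  · obtain ⟨t, rfl⟩ := hn
    push_cast
    exact h.dvd_natCast.mul_right _

theorem dvd_natCast_iff (h : IsSplitPrime σ p ρ) {n : ℕ} (hn : n < p) :
    ρ ∣ (n : 𝓞 K) ↔ n = 0 := by
  have := h.dvd_intCast_iff n
  rw [Int.cast_natCast] at this
  rw [this]
  norm_cast
  exact ⟨fun h' => Nat.eq_zero_of_dvd_of_lt h' hn, fun h' => h' ▸ dvd_zero _⟩

/-- The residue field is `𝔽_p`. The trace `t` of `ρ` is prime to `p`, since otherwise `ρ ∣ ρ̄`; so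
`a ≡ u t a ≡ u a ρ̄ ≡ u·tr(a ρ̄)` modulo `ρ`, where `u` inverts `t` modulo `p`. -/
theorem exists_intCast_sub (h : IsSplitPrime σ p ρ) (a : 𝓞 K) : ∃ (j : ℤ) (b : 𝓞 K), a = j + ρ * b := by
  set t := Algebra.trace ℤ (𝓞 K) ρ with ht
  set s := Algebra.trace ℤ (𝓞 K) (a * bar ρ) with hs
  have h1 : ρ + bar ρ = t := add_bar ρ
  have h2 : a * bar ρ + bar a * ρ = s := by
    rw [hs, ← add_bar, bar_mul, bar_bar]
  have h3 : ¬ (p : ℤ) ∣ t := fun h' => h.not_dvd_bar (by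
    have h4 := (h.dvd_intCast_iff t).mpr h'
    rw [← h1] at h4
    exact (dvd_add_right dvd_rfl).mp h4)
  obtain ⟨v, u, huv⟩ :=
    (Nat.prime_iff_prime_int.mp h.prime_nat).irreducible.coprime_iff_not_dvd.mpr h3
  have h4 : (1 : 𝓞 K) = v * p + u * t := by exact_mod_cast congrArg (Int.cast (R := 𝓞 K)) huv.symm
  refine ⟨u * s, a * v * bar ρ + u * a - u * bar a, ?_⟩
  push_cast
  linear_combination a * h4 - a * v * h.mul_bar - u * a * h1 + u * h2

/-- Because every residue class modulo `ρ` contains a rational integer, testing the dual pairing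
against `1` alone already decides divisibility. -/
theorem dvd_iff_trDiff (h : IsSplitPrime σ p ρ) (y : 𝓞 K) :
    (∃ n : ℤ, trDiff K (σ y / σ ρ) = n) ↔ ρ ∣ y := by
  refine ⟨fun ⟨n, hn⟩ => ?_, fun hy => ?_⟩
  · by_contra hy
    obtain ⟨a, ha⟩ := exists_trDiff_ne σ (σ y / σ ρ) (fun r hr => hy ⟨r, by
      rw [← emb_inj σ, emb_mul, ← hr, mul_div_cancel₀ _ h.emb_ne_zero]⟩)
    obtain ⟨j, b, rfl⟩ := h.exists_intCast_sub a
    obtain ⟨n', hn'⟩ := exists_trDiff_eq σ (y * b)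
    refine ha (j * n + n') ?_
    have h1 : σ y / σ ρ * σ ((j + ρ * b : 𝓞 K) : K) = j * (σ y / σ ρ) + σ (y * b : 𝓞 K) := by
      have := h.emb_ne_zero
      rw [emb_add, emb_mul, emb_mul, emb_intCast]
      field_simp
    have h2 : trDiff K (j * (σ y / σ ρ)) = j * trDiff K (σ y / σ ρ) := by
      simp only [trDiff, map_mul, map_intCast]
      ring
    rw [h1, trDiff_add, h2, hn, hn']
    push_cast
    ring
  · have := exists_trDiff_eq_of_dvd (σ := σ) h.prime.ne_zero hy 1
    simpa [div_eq_mul_inv] using this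

open Classical in
theorem sum_e_trDiff (h : IsSplitPrime σ p ρ) (y : 𝓞 K) :
    (1 / p : ℂ) * ∑ j ∈ Finset.range p, e (-(j * trDiff K (σ y / σ ρ))) =
      if ρ ∣ y then 1 else 0 := by
  have h1 : ∃ n : ℤ, p * trDiff K (σ y / σ ρ) = n := by
    obtain ⟨n, hn⟩ := exists_trDiff_eq σ (y * bar ρ)
    refine ⟨n, ?_⟩
    rw [← hn, ← trDiff_natCast_mul, ← h.emb_mul_conj, emb_mul, map_bar]
    have := h.emb_ne_zero
    congr 1
    field_simp
  rw [sum_e_eq p h.prime_nat.pos _ h1]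
  simp only [h.dvd_iff_trDiff]

theorem not_coprime_natCast [IsPrincipalIdealRing (𝓞 K)] (h : IsSplitPrime σ p ρ) {r : 𝓞 K}
    (hr : ¬ IsCoprime r (p : 𝓞 K)) : ρ ∣ r ∨ bar ρ ∣ r := by
  by_contra! h'
  refine hr ?_
  rw [← h.mul_bar]
  exact IsCoprime.mul_right
    (isCoprime_comm.mp (h.prime.irreducible.coprime_iff_not_dvd.mpr h'.1))
    (isCoprime_comm.mp (h.conj_prime.prime.irreducible.coprime_iff_not_dvd.mpr h'.2))

end IsSplitPrime

theorem e_eq_one_of_trace {X : ℂ} (y : 𝓞 K) (h : X = σ y + conj (σ y)) : e X = 1 := by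
  rw [h, ← trace_eq_add_conj, e_intCast]

theorem trDiff_mul_sqrtDiscr (w : ℂ) : trDiff K (w * σ (sqrtDiscr σ)) = w + conj w := by
  rw [trDiff, sqrtDiscr_spec, map_mul, conj_I_mul_sqrtAbsDiscr,
    div_eq_iff I_mul_sqrtAbsDiscr_ne_zero]
  ring

end SplitPrime

/-! ### Averaging over the multiples of `1/ρ`. -/

section Averages

set_option linter.unusedSectionVars false

/-- The mean of the translations `opB` over the multiples of `1 / ρ`. -/
noncomputable def avgB (p : ℕ) (ρ : ℂ) :
    (UpperHalfPlane → ℂ → ℂ → ℂ) →ₗ[ℂ] (UpperHalfPlane → ℂ → ℂ → ℂ) :=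
  (1 / p : ℂ) • ∑ j ∈ Finset.range p, opB (j / ρ)

/-- The mean of the operators `opA` over the multiples of `1 / ρ`. -/
noncomputable def avgA (p : ℕ) (ρ : ℂ) :
    (UpperHalfPlane → ℂ → ℂ → ℂ) →ₗ[ℂ] (UpperHalfPlane → ℂ → ℂ → ℂ) :=
  (1 / p : ℂ) • ∑ j ∈ Finset.range p, opA p (j / ρ)

theorem avgB_apply (p : ℕ) (ρ : ℂ) (f : UpperHalfPlane → ℂ → ℂ → ℂ) :
    avgB p ρ f = (1 / p : ℂ) • ∑ j ∈ Finset.range p, opB (j / ρ) f := by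
  simp [avgB]

theorem avgA_apply (p : ℕ) (ρ : ℂ) (f : UpperHalfPlane → ℂ → ℂ → ℂ) :
    avgA p ρ f = (1 / p : ℂ) • ∑ j ∈ Finset.range p, opA p (j / ρ) f := by
  simp [avgA]

theorem opB_avgB (p : ℕ) (ρ u : ℂ) (f : UpperHalfPlane → ℂ → ℂ → ℂ) :
    opB u (avgB p ρ f) = avgB p ρ (opB u f) := by
  simp only [avgB_apply, map_smul, map_sum, opB_comm f u]

theorem opA_avgA (p : ℕ) (ρ u : ℂ) (f : UpperHalfPlane → ℂ → ℂ → ℂ) :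
    opA p u (avgA p ρ f) = avgA p ρ (opA p u f) := by
  simp only [avgA_apply, map_smul, map_sum, opA_comm f p u]

variable {K : Type*} [Field K] [NumberField K]
variable [Algebra.IsQuadraticExtension ℚ K] [IsTotallyComplex K] {σ : K →+* ℂ}
  {k : ℤ} {p : ℕ} {ρ : 𝓞 K} {f φ : UpperHalfPlane → ℂ → ℂ → ℂ}

namespace IsSplitPrime

/-- For two multiples of `1/ρ` the commutator exponent is `tr(x ȳ)`, an integer because `N(ρ) = p`
cancels the index. -/
theorem opB_opA_comm (h : IsSplitPrime σ p ρ) (x y : 𝓞 K) (f : UpperHalfPlane → ℂ → ℂ → ℂ) :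
    opB (σ y / σ ρ) (opA p (σ x / σ ρ) f) = opA p (σ x / σ ρ) (opB (σ y / σ ρ) f) := by
  rw [opB_opA, e_eq_one_of_trace (σ := σ) (x * bar y), one_smul]
  have h1 := h.emb_ne_zero
  have h2 := h.conj_emb_ne_zero
  rw [← h.emb_mul_conj, emb_mul, map_bar, map_div₀, map_div₀, map_mul, conj_conj]
  field_simp

theorem opB_opA_emb_comm (h : IsSplitPrime σ p ρ) (x y : 𝓞 K)
    (f : UpperHalfPlane → ℂ → ℂ → ℂ) :
    opB (σ y / σ ρ) (opA p (σ x) f) = opA p (σ x) (opB (σ y / σ ρ) f) := by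
  have := h.opB_opA_comm (x * ρ) y f
  rwa [emb_mul, mul_div_cancel_right₀ _ h.emb_ne_zero] at this

theorem avgB_opA_comm (h : IsSplitPrime σ p ρ) (x : 𝓞 K) (f : UpperHalfPlane → ℂ → ℂ → ℂ) :
    avgB p (σ ρ) (opA p (σ x / σ ρ) f) = opA p (σ x / σ ρ) (avgB p (σ ρ) f) := by
  simp only [avgB_apply, map_smul, map_sum]
  congr 1
  refine Finset.sum_congr rfl fun j _ => ?_
  simpa using h.opB_opA_comm x (j : 𝓞 K) f

theorem avgA_opB_comm (h : IsSplitPrime σ p ρ) (x : 𝓞 K) (f : UpperHalfPlane → ℂ → ℂ → ℂ) :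
    avgA p (σ ρ) (opB (σ x / σ ρ) f) = opB (σ x / σ ρ) (avgA p (σ ρ) f) := by
  simp only [avgA_apply, map_smul, map_sum]
  congr 1
  refine Finset.sum_congr rfl fun j _ => ?_
  simpa using (h.opB_opA_comm (j : 𝓞 K) x f).symm

theorem avgA_avgB_comm (h : IsSplitPrime σ p ρ) (f : UpperHalfPlane → ℂ → ℂ → ℂ) :
    avgA p (σ ρ) (avgB p (σ ρ) f) = avgB p (σ ρ) (avgA p (σ ρ) f) := by
  rw [avgA_apply, avgA_apply, map_smul, map_sum]
  congr 1
  refine Finset.sum_congr rfl fun j _ => ?_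
  simpa using (h.avgB_opA_comm (j : 𝓞 K) f).symm

/-- Modulo `𝓞 K` the multiples of `1/ρ` form a cyclic group of order `p` generated by `1/ρ`, so the
sum runs over a full orbit. Stated for a general additive family, to serve both `opA` and `opB`. -/
theorem sum_translates_eq (h : IsSplitPrime σ p ρ)
    {X : ℂ → (UpperHalfPlane → ℂ → ℂ → ℂ) →ₗ[ℂ] (UpperHalfPlane → ℂ → ℂ → ℂ)}
    (hX0 : ∀ f, X 0 f = f) (hX : ∀ u v f, X u (X v f) = X (u + v) f)
    (hf : ∀ l : 𝓞 K, X (σ l) f = f) (a : 𝓞 K) :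
    X (σ a / σ ρ) (∑ j ∈ Finset.range p, X (j / σ ρ) f) =
      ∑ j ∈ Finset.range p, X (j / σ ρ) f := by
  have h0 := h.emb_ne_zero
  set g := ∑ j ∈ Finset.range p, X (j / σ ρ) f with hg
  have h1 : X (1 / σ ρ) g = g := by
    rw [hg, map_sum]
    have h2 := Finset.sum_range_succ (fun j : ℕ => X (j / σ ρ) f) p
    rw [Finset.sum_range_succ'] at h2
    -- The sum closes up because `p/ρ = ρ̄` is integral.
    have h3 : X (p / σ ρ) f = f := by
      have := hf (bar ρ)
      rwa [map_bar, ← mul_div_cancel_left₀ (conj (σ ρ)) h0, h.emb_mul_conj] at this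
    rw [h3, Nat.cast_zero, zero_div, hX0] at h2
    rw [← add_right_cancel h2]
    refine Finset.sum_congr rfl fun j _ => ?_
    rw [hX]
    push_cast
    ring_nf
  have h4 : ∀ n : ℕ, X (n / σ ρ) g = g := by
    intro n
    induction n with
    | zero => simp [hX0]
    | succ n ih =>
      conv_rhs => rw [← ih, ← h1]
      rw [hX]
      push_cast
      ring_nf
  have h5 : ∀ n : ℤ, X (n / σ ρ) g = g := by
    intro n
    obtain ⟨n, rfl | rfl⟩ := n.eq_nat_or_neg
    · exact_mod_cast h4 n
    · conv_lhs => rw [← h4 n]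
      have h6 : ((-(n : ℤ) : ℤ) : ℂ) / σ ρ + n / σ ρ = 0 := by
        push_cast
        ring
      rw [hX, h6, hX0]
  obtain ⟨j, b, rfl⟩ := h.exists_intCast_sub a
  have h6 : σ ((j + ρ * b : 𝓞 K) : K) / σ ρ = j / σ ρ + σ b := by
    rw [emb_add, emb_mul, emb_intCast]
    field_simp
  have h7 : X (σ b) g = g := by
    rw [hg, map_sum]
    refine Finset.sum_congr rfl fun j _ => ?_
    rw [hX, add_comm, ← hX, hf]
  rw [h6, ← hX, h7, h5]

theorem opB_avgB_eq (h : IsSplitPrime σ p ρ) (hB : ∀ l : 𝓞 K, opB (σ l) f = f) (a : 𝓞 K) :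
    opB (σ a / σ ρ) (avgB p (σ ρ) f) = avgB p (σ ρ) f := by
  rw [avgB_apply, map_smul,
    h.sum_translates_eq opB_zero (fun u v f => opB_opB f u v) hB]

theorem opA_avgA_eq (h : IsSplitPrime σ p ρ) (hA : ∀ l : 𝓞 K, opA p (σ l) f = f) (a : 𝓞 K) :
    opA p (σ a / σ ρ) (avgA p (σ ρ) f) = avgA p (σ ρ) f := by
  rw [avgA_apply, map_smul, h.sum_translates_eq (X := fun l => opA p l)
    (fun f => opA_zero f p) (fun u v f => opA_opA f p u v) hA]

end IsSplitPrime

end Averages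

/-! ### Decomposition of a form supported on the multiples of `ρ` or `ρ̄`. -/

section Splitting

set_option linter.unusedSectionVars false

theorem opS_S_opA (k : ℤ) (m : ℕ) (l : ℂ) (f : UpperHalfPlane → ℂ → ℂ → ℂ) :
    opS k m 1 ModularGroup.S (opA m l f) = opB (-l) (opS k m 1 ModularGroup.S f) := by
  have h := opS_opA_opB f m l 0 k (ε := 1) (by simp) ModularGroup.S
  simpa [ModularGroup.S, opA_zero, opB_zero, e_zero] using h

theorem opS_S_opB (k : ℤ) (m : ℕ) (u : ℂ) (f : UpperHalfPlane → ℂ → ℂ → ℂ) :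
    opS k m 1 ModularGroup.S (opB u f) = opA m u (opS k m 1 ModularGroup.S f) := by
  have h := opS_opA_opB f m 0 u k (ε := 1) (by simp) ModularGroup.S
  simpa [ModularGroup.S, opA_zero, opB_zero, e_zero] using h

theorem opS_S_avgB (k : ℤ) (p : ℕ) (ρ : ℂ) (f : UpperHalfPlane → ℂ → ℂ → ℂ) :
    opS k p 1 ModularGroup.S (avgB p ρ f) = avgA p ρ (opS k p 1 ModularGroup.S f) := by
  simp only [avgB_apply, avgA_apply, map_smul, map_sum, opS_S_opB]

variable {K : Type*} [Field K] [NumberField K]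
variable [Algebra.IsQuadraticExtension ℚ K] [IsTotallyComplex K] {σ : K →+* ℂ}
  {k : ℤ} {p : ℕ} {ρ : 𝓞 K} {f φ : UpperHalfPlane → ℂ → ℂ → ℂ} {c : ℕ → 𝓞 K → ℂ}

namespace IsSplitPrime

/-- Moving `opA` out of the average twists it into the projection onto `r ≡ ρ̄ x̄ δ` modulo `ρ`.
This class is nonzero, so the support condition forces `ρ̄ ∣ r`, and translation by `a/ρ̄` acts
trivially. -/
theorem opB_avgB_opA_eq (h : IsSplitPrime σ p ρ) (hF : HasFourierExpansion σ p φ c)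
    (hc : ∀ n r, c n r ≠ 0 → ρ ∣ r ∨ bar ρ ∣ r) {x : 𝓞 K} (hx : ¬ bar ρ ∣ x) (a : 𝓞 K) :
    opB (σ a / σ (bar ρ)) (avgB p (σ ρ) (opA p (σ x / σ (bar ρ)) φ)) =
      avgB p (σ ρ) (opA p (σ x / σ (bar ρ)) φ) := by
  classical
  have h0 := h.emb_ne_zero
  have h0' := h.conj_emb_ne_zero
  set t := trDiff K (σ (bar ρ * bar x * sqrtDiscr σ : 𝓞 K) / σ ρ) with ht
  set ψ := (1 / p : ℂ) • ∑ j ∈ Finset.range p, e (j * t) • opB (j / σ ρ) φ with hψ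
  have h1 : avgB p (σ ρ) (opA p (σ x / σ (bar ρ)) φ) = opA p (σ x / σ (bar ρ)) ψ := by
    rw [avgB_apply, hψ, map_smul, map_sum]
    congr 1
    refine Finset.sum_congr rfl fun j _ => ?_
    rw [opB_opA, map_smul]
    congr 2
    have h2 : σ (bar ρ * bar x * sqrtDiscr σ : 𝓞 K) / σ ρ =
        conj (σ ρ) * conj (σ x) / σ ρ * σ (sqrtDiscr σ) := by
      simp only [emb_mul, map_bar]
      ring
    rw [ht, h2, trDiff_mul_sqrtDiscr, ← h.emb_mul_conj]
    simp only [map_div₀, map_mul, map_bar, conj_conj, map_natCast]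
    field_simp
    ring
  have h2 : HasFourierExpansion σ p ψ
      (fun n r => (if ρ ∣ r - bar ρ * bar x * sqrtDiscr σ then 1 else 0) * c n r) := by
    have h3 := (HasFourierExpansion.sum (s := Finset.range p) fun j _ =>
      (hF.opB (j / σ ρ)).smul (e (j * t))).smul (1 / p)
    refine h3.congr fun n r => ?_
    rw [← h.sum_e_trDiff]
    simp only [Pi.smul_apply, Finset.sum_apply, smul_eq_mul]
    rw [mul_assoc, Finset.sum_mul]
    congr 1
    refine Finset.sum_congr rfl fun j _ => ?_
    rw [← mul_assoc, ← e_add]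
    congr 2
    have h4 : trDiff K (σ r / σ ρ) =
        trDiff K (σ (r - bar ρ * bar x * sqrtDiscr σ : 𝓞 K) / σ ρ) + t := by
      rw [ht, ← trDiff_add, emb_sub]
      congr 1
      ring
    have h5 : trDiff K (σ r * (j / σ ρ)) = j * trDiff K (σ r / σ ρ) := by
      rw [← trDiff_natCast_mul]
      congr 1
      ring
    rw [h5, h4]
    ring
  have h3 : opB (σ a / σ (bar ρ)) ψ = ψ := by
    refine ((h2.opB _).congr fun n r => ?_).unique_fun h2
    by_cases h4 : ρ ∣ r - bar ρ * bar x * sqrtDiscr σ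
    · by_cases h5 : c n r = 0
      · simp [h5]
      · have h6 : bar ρ ∣ r := by
          refine (hc n r h5).resolve_left fun h6 => ?_
          have h7 : ρ ∣ bar ρ * bar x * sqrtDiscr σ := (dvd_sub_right h6).mp h4
          rcases h.prime.dvd_or_dvd h7 with h8 | h8
          · rcases h.prime.dvd_or_dvd h8 with h9 | h9
            · exact h.not_dvd_bar h9
            · exact hx (by simpa using bar_dvd h9)
          · exact h.not_dvd_sqrtDiscr h8
        obtain ⟨s, hs⟩ := exists_trDiff_eq_of_dvd (σ := σ) h.conj_prime.prime.ne_zero h6 a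
        rw [hs, e_neg, e_intCast, inv_one, one_mul]
    · simp [h4]
  rw [h1, h.conj_prime.opB_opA_comm, h3]

/-- The image under `S` of the preceding statement at `-x`. -/
theorem opA_avgA_opB_eq (h : IsSplitPrime σ p ρ) (hF : HasFourierExpansion σ p φ c)
    (hc : ∀ n r, c n r ≠ 0 → ρ ∣ r ∨ bar ρ ∣ r)
    (hS : opS k p 1 ModularGroup.S φ = φ) {x : 𝓞 K} (hx : ¬ bar ρ ∣ x) (a : 𝓞 K) :
    opA p (σ a / σ (bar ρ)) (avgA p (σ ρ) (opB (σ x / σ (bar ρ)) φ)) =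
      avgA p (σ ρ) (opB (σ x / σ (bar ρ)) φ) := by
  have h1 := congrArg (opS k p 1 ModularGroup.S)
    (h.opB_avgB_opA_eq hF hc (x := -x) (by rwa [dvd_neg]) a)
  rw [opS_S_opB, opS_S_avgB, opS_S_opA, hS] at h1
  simpa [neg_div] using h1

variable (σ p ρ φ) in
/-- The component of `φ` that is fixed by the operators `opA`, `opB` of the multiples of
`1 / ρ`, after translation by `(x, y) / ρ̄`. -/
noncomputable def component (x y : 𝓞 K) : UpperHalfPlane → ℂ → ℂ → ℂ :=
  avgA p (σ ρ) (avgB p (σ ρ) (opA p (σ x / σ (bar ρ)) (opB (σ y / σ (bar ρ)) φ)))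

theorem component_eq_left (h : IsSplitPrime σ p ρ) (hF : HasFourierExpansion σ p φ c)
    (hc : ∀ n r, c n r ≠ 0 → ρ ∣ r ∨ bar ρ ∣ r) {x : 𝓞 K} (hx : ¬ bar ρ ∣ x) (y y' : 𝓞 K) :
    component σ p ρ φ x y = component σ p ρ φ x y' := by
  have key : ∀ y, component σ p ρ φ x y =
      avgA p (σ ρ) (avgB p (σ ρ) (opA p (σ x / σ (bar ρ)) φ)) := by
    intro y
    rw [component, ← h.conj_prime.opB_opA_comm, ← opB_avgB, h.opB_avgB_opA_eq hF hc hx]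
  rw [key, key]

theorem component_eq_right (h : IsSplitPrime σ p ρ) (hF : HasFourierExpansion σ p φ c)
    (hc : ∀ n r, c n r ≠ 0 → ρ ∣ r ∨ bar ρ ∣ r)
    (hS : opS k p 1 ModularGroup.S φ = φ) {y : 𝓞 K} (hy : ¬ bar ρ ∣ y) (x x' : 𝓞 K) :
    component σ p ρ φ x y = component σ p ρ φ x' y := by
  have key : ∀ x, component σ p ρ φ x y =
      avgB p (σ ρ) (avgA p (σ ρ) (opB (σ y / σ (bar ρ)) φ)) := by
    intro x
    rw [component, h.avgA_avgB_comm, ← opA_avgA, h.opA_avgA_opB_eq hF hc hS hy]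
  rw [key, key]

theorem component_eq (h : IsSplitPrime σ p ρ) (hF : HasFourierExpansion σ p φ c)
    (hc : ∀ n r, c n r ≠ 0 → ρ ∣ r ∨ bar ρ ∣ r)
    (hS : opS k p 1 ModularGroup.S φ = φ) {x y : 𝓞 K} (hxy : ¬ bar ρ ∣ x ∨ ¬ bar ρ ∣ y) :
    component σ p ρ φ x y = component σ p ρ φ 0 1 := by
  have h1 : ¬ bar ρ ∣ (1 : 𝓞 K) := fun h' => h.conj_prime.prime.not_isUnit (isUnit_of_dvd_one h')
  rcases hxy with hx | hy
  · rw [h.component_eq_left hF hc hx y 1, h.component_eq_right hF hc hS h1 x 0]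
  · rw [h.component_eq_right hF hc hS hy x 1, h.component_eq_left hF hc h1 y 1,
      h.component_eq_right hF hc hS h1 1 0]

/-- Conjugation by `opA` at `x/ρ̄` multiplies the `j`-th translation by a character of `x`,
nontrivial for `0 < j < p` as `ρ` divides none of `j`, `ρ̄`, `δ`. Summing over `x` leaves only `j =
0`. -/
theorem sum_opA_avgB_opA (h : IsSplitPrime σ p ρ) (f : UpperHalfPlane → ℂ → ℂ → ℂ) :
    ∑ x ∈ Finset.range p, opA p (x / σ (bar ρ)) (avgB p (σ ρ) (opA p (-(x / σ (bar ρ))) f)) =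
      f := by
  classical
  have h0 := h.emb_ne_zero
  have h0' := h.conj_emb_ne_zero
  have h1 : ∀ x j : ℕ, opA p (x / σ (bar ρ)) (opB (j / σ ρ) (opA p (-(x / σ (bar ρ))) f)) =
      e (-(x * trDiff K (σ ((j : 𝓞 K) * bar ρ * sqrtDiscr σ : 𝓞 K) / σ ρ))) •
        opB (j / σ ρ) f := by
    intro x j
    have h2 := opB_opA (opA p (-(x / σ (bar ρ))) f) p (x / σ (bar ρ)) (j / σ ρ)
    rw [opA_opA, add_neg_cancel, opA_zero] at h2
    rw [h2, smul_smul, ← e_add]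
    have h3 : σ ((j : 𝓞 K) * bar ρ * sqrtDiscr σ : 𝓞 K) / σ ρ =
        j * conj (σ ρ) / σ ρ * σ (sqrtDiscr σ) := by
      simp only [emb_mul, map_bar, emb_natCast]
      ring
    rw [h3, trDiff_mul_sqrtDiscr, ← h.emb_mul_conj]
    simp only [map_div₀, map_mul, map_bar, conj_conj, map_natCast]
    convert (one_smul ℂ _).symm using 2
    rw [← e_zero]
    congr 1
    field_simp
    ring
  have h2 : ∀ j ∈ Finset.range p, ∑ x ∈ Finset.range p,
      (1 / p : ℂ) * e (-(x * trDiff K (σ ((j : 𝓞 K) * bar ρ * sqrtDiscr σ : 𝓞 K) / σ ρ))) =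
        if j = 0 then 1 else 0 := by
    intro j hj
    rw [← Finset.mul_sum, h.sum_e_trDiff]
    congr 1
    rw [h.prime.dvd_mul, h.prime.dvd_mul, h.dvd_natCast_iff (Finset.mem_range.mp hj)]
    simp [h.not_dvd_bar, h.not_dvd_sqrtDiscr]
  simp only [avgB_apply, map_smul, map_sum, h1, Finset.smul_sum, smul_smul]
  rw [Finset.sum_comm]
  simp only [← Finset.sum_smul]
  rw [Finset.sum_congr rfl fun j hj => by rw [h2 j hj]]
  simp [h.prime_nat.pos, opB_zero]

theorem sum_opB_avgA_opB (h : IsSplitPrime σ p ρ) (f : UpperHalfPlane → ℂ → ℂ → ℂ) :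
    ∑ x ∈ Finset.range p, opB (x / σ (bar ρ)) (avgA p (σ ρ) (opB (-(x / σ (bar ρ))) f)) =
      f := by
  classical
  have h0 := h.emb_ne_zero
  have h0' := h.conj_emb_ne_zero
  have h1 : ∀ x j : ℕ, opB (x / σ (bar ρ)) (opA p (j / σ ρ) (opB (-(x / σ (bar ρ))) f)) =
      e (-(x * trDiff K (σ (-(j : 𝓞 K) * bar ρ * sqrtDiscr σ : 𝓞 K) / σ ρ))) •
        opA p (j / σ ρ) f := by
    intro x j
    rw [opB_opA, opB_opB, add_neg_cancel, opB_zero]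
    have h3 : σ (-(j : 𝓞 K) * bar ρ * sqrtDiscr σ : 𝓞 K) / σ ρ =
        -(j * conj (σ ρ)) / σ ρ * σ (sqrtDiscr σ) := by
      simp only [neg_mul, ← map_bar, ← emb_natCast σ j, ← emb_mul]
      simp
      ring
    rw [h3, trDiff_mul_sqrtDiscr, ← h.emb_mul_conj]
    simp only [map_div₀, map_mul, map_bar, conj_conj, map_natCast, map_neg]
    congr 2
    field_simp
    ring
  have h2 : ∀ j ∈ Finset.range p, ∑ x ∈ Finset.range p,
      (1 / p : ℂ) * e (-(x * trDiff K (σ (-(j : 𝓞 K) * bar ρ * sqrtDiscr σ : 𝓞 K) / σ ρ))) =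
        if j = 0 then 1 else 0 := by
    intro j hj
    rw [← Finset.mul_sum, h.sum_e_trDiff]
    congr 1
    rw [h.prime.dvd_mul, h.prime.dvd_mul, dvd_neg, h.dvd_natCast_iff (Finset.mem_range.mp hj)]
    simp [h.not_dvd_bar, h.not_dvd_sqrtDiscr]
  simp only [avgA_apply, map_smul, map_sum, h1, Finset.smul_sum, smul_smul]
  rw [Finset.sum_comm]
  simp only [← Finset.sum_smul]
  rw [Finset.sum_congr rfl fun j hj => by rw [h2 j hj]]
  simp [h.prime_nat.pos, opA_zero]

/-- A resolution of the identity: the conjugates of the `1/ρ` projector by the translations by `(x,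
y)/ρ̄` add up to `1`. -/
theorem eq_sum_component (h : IsSplitPrime σ p ρ) (φ : UpperHalfPlane → ℂ → ℂ → ℂ) :
    φ = ∑ y ∈ Finset.range p, ∑ x ∈ Finset.range p,
      opB (y / σ (bar ρ)) (opA p (x / σ (bar ρ)) (component σ p ρ φ (-x) (-y))) := by
  have h1 : ∀ x y : ℕ, opB (y / σ (bar ρ)) (opA p (x / σ (bar ρ))
      (component σ p ρ φ (-x) (-y))) = opB (y / σ (bar ρ)) (avgA p (σ ρ)
        (opB (-(y / σ (bar ρ))) (opA p (x / σ (bar ρ)) (avgB p (σ ρ)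
          (opA p (-(x / σ (bar ρ))) φ))))) := by
    intro x y
    have hx : σ ((-(x : 𝓞 K) : 𝓞 K) : K) / σ (bar ρ) = -(x / σ (bar ρ)) := by
      simp [neg_div]
    have hy : σ ((-(y : 𝓞 K) : 𝓞 K) : K) / σ (bar ρ) = -(y / σ (bar ρ)) := by
      simp [neg_div]
    have h2 := h.conj_prime.opB_opA_comm (-x) (-y) φ
    have h3 := h.conj_prime.opB_opA_comm x (-y) (avgB p (σ ρ) (opA p (-(x / σ (bar ρ))) φ))
    rw [emb_natCast] at h3
    rw [hx, hy] at h2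
    rw [hy] at h3
    rw [component, hx, hy, ← h2, ← opB_avgB, opA_avgA, h3]
  simp only [h1, ← map_sum, h.sum_opA_avgB_opA, h.sum_opB_avgA_opB]

/-- If all components in `eq_sum_component` were equal to `G`, the sum would be `p²` times the
`ρ̄`-average of `G`. Only the term `(0, 0)` deviates, and it contributes the first summand. -/
theorem eq_add_component (h : IsSplitPrime σ p ρ) (hF : HasFourierExpansion σ p φ c)
    (hc : ∀ n r, c n r ≠ 0 → ρ ∣ r ∨ bar ρ ∣ r)
    (hS : opS k p 1 ModularGroup.S φ = φ) :
    φ = (component σ p ρ φ 0 0 - component σ p ρ φ 0 1) +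
      (p : ℂ) ^ 2 • avgA p (σ (bar ρ)) (avgB p (σ (bar ρ)) (component σ p ρ φ 0 1)) := by
  rw [h.conj_prime.avgA_avgB_comm]
  have hp := h.natCast_ne_zero
  set G := component σ p ρ φ 0 1 with hG
  have h1 : ∀ y ∈ Finset.range p, ∀ x ∈ Finset.range p,
      opB (y / σ (bar ρ)) (opA p (x / σ (bar ρ)) (component σ p ρ φ (-x) (-y))) =
      opB (y / σ (bar ρ)) (opA p (x / σ (bar ρ)) G) +
        if x = 0 then (if y = 0 then component σ p ρ φ 0 0 - G else 0) else 0 := by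
    intro y hy x hx
    by_cases hx0 : x = 0
    · by_cases hy0 : y = 0
      · simp [hx0, hy0, opA_zero, opB_zero]
      · rw [if_neg hy0, ite_self, add_zero, h.component_eq hF hc hS (Or.inr ?_)]
        rw [dvd_neg, h.conj_prime.dvd_natCast_iff (Finset.mem_range.mp hy)]
        exact hy0
    · rw [if_neg hx0, add_zero, h.component_eq hF hc hS (Or.inl ?_)]
      rw [dvd_neg, h.conj_prime.dvd_natCast_iff (Finset.mem_range.mp hx)]
      exact hx0
  have h2 : (p : ℂ) ^ 2 • avgB p (σ (bar ρ)) (avgA p (σ (bar ρ)) G) =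
      ∑ y ∈ Finset.range p, ∑ x ∈ Finset.range p,
        opB (y / σ (bar ρ)) (opA p (x / σ (bar ρ)) G) := by
    simp only [avgB_apply, avgA_apply, map_smul, map_sum, ← Finset.smul_sum, smul_smul]
    rw [show (p : ℂ) ^ 2 * (1 / p * (1 / p)) = 1 by field_simp, one_smul]
    exact Finset.sum_comm
  conv_lhs => rw [h.eq_sum_component φ]
  rw [Finset.sum_congr rfl fun y hy => Finset.sum_congr rfl fun x hx => h1 y hy x hx, h2]
  simp only [Finset.sum_add_distrib, Finset.sum_ite_eq', Finset.mem_range, h.prime_nat.pos,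
    if_true]
  rw [add_comm]

end IsSplitPrime

end Splitting

/-! ### From fixed functions to forms of index one. -/

section Descent

set_option linter.unusedSectionVars false

variable {K : Type*} [Field K] [NumberField K]
variable [Algebra.IsQuadraticExtension ℚ K] [IsTotallyComplex K] {σ : K →+* ℂ}
  {k : ℤ} {p : ℕ} {ρ : 𝓞 K} {f φ : UpperHalfPlane → ℂ → ℂ → ℂ} {c : ℕ → 𝓞 K → ℂ}

variable (σ p ρ) in
/-- The functions fixed by the operators `opA`, `opB` of the multiples of `1 / ρ`. -/
def fixedSubmodule : Submodule ℂ (UpperHalfPlane → ℂ → ℂ → ℂ) where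
  carrier := {f | ∀ a : 𝓞 K, opA p (σ a / σ ρ) f = f ∧ opB (σ a / σ ρ) f = f}
  zero_mem' a := by simp
  add_mem' hf hg a := by
    rw [map_add, map_add, (hf a).1, (hg a).1, (hf a).2, (hg a).2]
    exact ⟨rfl, rfl⟩
  smul_mem' t f hf a := by
    rw [map_smul, map_smul, (hf a).1, (hf a).2]
    exact ⟨rfl, rfl⟩

namespace IsSplitPrime

theorem opA_emb_of_mem (h : IsSplitPrime σ p ρ) (hf : f ∈ fixedSubmodule σ p ρ) (l : 𝓞 K) :
    opA p (σ l) f = f := by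
  have := (hf (l * ρ)).1
  rwa [emb_mul, mul_div_cancel_right₀ _ h.emb_ne_zero] at this

theorem opB_emb_of_mem (h : IsSplitPrime σ p ρ) (hf : f ∈ fixedSubmodule σ p ρ) (l : 𝓞 K) :
    opB (σ l) f = f := by
  have := (hf (l * ρ)).2
  rwa [emb_mul, mul_div_cancel_right₀ _ h.emb_ne_zero] at this

theorem avgA_avgB_mem (h : IsSplitPrime σ p ρ) (hA : ∀ l : 𝓞 K, opA p (σ l) f = f)
    (hB : ∀ l : 𝓞 K, opB (σ l) f = f) :
    avgA p (σ ρ) (avgB p (σ ρ) f) ∈ fixedSubmodule σ p ρ := by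
  intro a
  constructor
  · refine h.opA_avgA_eq (fun l => ?_) a
    have := h.avgB_opA_comm (l * ρ) f
    rwa [emb_mul, mul_div_cancel_right₀ _ h.emb_ne_zero, hA, eq_comm] at this
  · rw [← h.avgA_opB_comm, h.opB_avgB_eq hB]

/-- The multiples of `1/ρ` are stable under `SL₂(ℤ)` and the units, and on them the cocycle of
`opS_opA_opB` is trivial. -/
theorem opS_mem (h : IsSplitPrime σ p ρ) (hf : f ∈ fixedSubmodule σ p ρ) (ε : (𝓞 K)ˣ)
    (hε : σ (ε : 𝓞 K) * conj (σ (ε : 𝓞 K)) = 1) (M : Matrix.SpecialLinearGroup (Fin 2) ℤ) :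
    opS k p (σ (ε : 𝓞 K)) M f ∈ fixedSubmodule σ p ρ := by
  have h0 := h.emb_ne_zero
  have h0' := h.conj_emb_ne_zero
  have hdet : (M 0 0 : ℂ) * M 1 1 - M 0 1 * M 1 0 = 1 := by
    have := M.det_coe
    rw [Matrix.det_fin_two] at this
    exact_mod_cast this
  have key : ∀ a b : 𝓞 K, opA p (conj (σ (ε : 𝓞 K)) * (M 0 0 * (σ a / σ ρ) + M 1 0 * (σ b / σ ρ)))
      (opB (conj (σ (ε : 𝓞 K)) * (M 0 1 * (σ a / σ ρ) + M 1 1 * (σ b / σ ρ)))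
        (opS k p (σ (ε : 𝓞 K)) M f)) = opS k p (σ (ε : 𝓞 K)) M f := by
    intro a b
    have h1 := opS_opA_opB f p (σ a / σ ρ) (σ b / σ ρ) k hε M
    rw [(hf b).2, (hf a).1] at h1
    have h2 : e (p * (M 0 0 * M 0 1 * (σ a / σ ρ * conj (σ a / σ ρ)) +
        M 1 0 * M 1 1 * (σ b / σ ρ * conj (σ b / σ ρ)) + M 0 1 * M 1 0 *
          (σ a / σ ρ * conj (σ b / σ ρ) + conj (σ a / σ ρ) * (σ b / σ ρ)))) = 1 := by
      rw [e_eq_one_iff]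
      refine ⟨M 0 0 * M 0 1 * nrm a + M 1 0 * M 1 1 * nrm b +
        M 0 1 * M 1 0 * Algebra.trace ℤ (𝓞 K) (a * bar b), ?_⟩
      push_cast
      rw [nrm_eq σ, nrm_eq σ, trace_eq_add_conj σ, emb_mul, map_bar, map_div₀, map_div₀, map_mul,
        conj_conj, ← h.emb_mul_conj]
      field_simp
    rw [h2, one_smul] at h1
    exact h1.symm
  intro a
  constructor
  -- The arguments are the entries of `ε (a, 0) M⁻¹`; the second half uses `ε (0, a) M⁻¹`.
  · have h1 := key (ε * (M 1 1 * a)) (-(ε * (M 0 1 * a)))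
    have h2 : conj (σ (ε : 𝓞 K)) * (M 0 0 * (σ (ε * (M 1 1 * a) : 𝓞 K) / σ ρ) +
        M 1 0 * (σ (-(ε * (M 0 1 * a)) : 𝓞 K) / σ ρ)) = σ a / σ ρ := by
      rw [← neg_mul, ← neg_one_mul, show (-1 : 𝓞 K) = ((-1 : ℤ) : 𝓞 K) by simp]
      simp only [emb_mul, emb_intCast]
      push_cast
      linear_combination (conj (σ (ε : 𝓞 K)) * σ (ε : 𝓞 K) * σ a / σ ρ) * hdet + σ a / σ ρ * hε
    have h3 : conj (σ (ε : 𝓞 K)) * (M 0 1 * (σ (ε * (M 1 1 * a) : 𝓞 K) / σ ρ) +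
        M 1 1 * (σ (-(ε * (M 0 1 * a)) : 𝓞 K) / σ ρ)) = 0 := by
      rw [← neg_mul, ← neg_one_mul, show (-1 : 𝓞 K) = ((-1 : ℤ) : 𝓞 K) by simp]
      simp only [emb_mul, emb_intCast]
      push_cast
      ring
    rwa [h2, h3, opB_zero] at h1
  · have h1 := key (-(ε * (M 1 0 * a))) (ε * (M 0 0 * a))
    have h2 : conj (σ (ε : 𝓞 K)) * (M 0 0 * (σ (-(ε * (M 1 0 * a)) : 𝓞 K) / σ ρ) +
        M 1 0 * (σ (ε * (M 0 0 * a) : 𝓞 K) / σ ρ)) = 0 := by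
      rw [← neg_mul, ← neg_one_mul, show (-1 : 𝓞 K) = ((-1 : ℤ) : 𝓞 K) by simp]
      simp only [emb_mul, emb_intCast]
      push_cast
      ring
    have h3 : conj (σ (ε : 𝓞 K)) * (M 0 1 * (σ (-(ε * (M 1 0 * a)) : 𝓞 K) / σ ρ) +
        M 1 1 * (σ (ε * (M 0 0 * a) : 𝓞 K) / σ ρ)) = σ a / σ ρ := by
      rw [← neg_mul, ← neg_one_mul, show (-1 : 𝓞 K) = ((-1 : ℤ) : 𝓞 K) by simp]
      simp only [emb_mul, emb_intCast]
      push_cast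
      linear_combination (conj (σ (ε : 𝓞 K)) * σ (ε : 𝓞 K) * σ a / σ ρ) * hdet + σ a / σ ρ * hε
    rwa [h2, h3, opA_zero] at h1

/-- Translations from `1/ρ` and `1/ρ̄` commute only up to `e(tr(ρ̄ a/ρ))`. As `ρ` divides neither
`ρ̄` nor `δ`, some `a` makes this scalar different from `1`. -/
theorem eq_zero_of_mem (h : IsSplitPrime σ p ρ) (hf : f ∈ fixedSubmodule σ p ρ)
    (hf' : f ∈ fixedSubmodule σ p (bar ρ)) : f = 0 := by
  have h0 := h.emb_ne_zero
  have h0' := h.conj_emb_ne_zero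
  obtain ⟨a, ha⟩ := exists_trDiff_ne σ (conj (σ ρ) * σ (sqrtDiscr σ) / σ ρ) (fun r hr => by
    have h1 : bar ρ * sqrtDiscr σ = ρ * r := by
      rw [← emb_inj σ, emb_mul, emb_mul, ← hr, map_bar]
      field_simp
    rcases h.prime.dvd_or_dvd (⟨r, h1⟩ : ρ ∣ bar ρ * sqrtDiscr σ) with h2 | h2
    · exact h.not_dvd_bar h2
    · exact h.not_dvd_sqrtDiscr h2)
  have h1 := opB_opA f p (σ 1 / σ ρ) (σ (bar a) / σ (bar ρ))
  rw [(hf' (bar a)).2, (show opA p (σ 1 / σ ρ) f = f by simpa using (hf 1).1),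
    (hf' (bar a)).2] at h1
  have h2 : (p : ℂ) * (σ 1 / σ ρ * conj (σ (bar a) / σ (bar ρ)) +
      conj (σ 1 / σ ρ) * (σ (bar a) / σ (bar ρ))) =
        trDiff K (conj (σ ρ) * σ (sqrtDiscr σ) / σ ρ * σ a) := by
    rw [show conj (σ ρ) * σ (sqrtDiscr σ) / σ ρ * σ a =
      conj (σ ρ) * σ a / σ ρ * σ (sqrtDiscr σ) by ring, trDiff_mul_sqrtDiscr, ← h.emb_mul_conj]
    simp only [map_div₀, map_mul, map_bar, conj_conj, map_one]
    field_simp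
  rw [h2] at h1
  have h3 : (e (trDiff K (conj (σ ρ) * σ (sqrtDiscr σ) / σ ρ * σ a)) - 1) • f = 0 := by
    rw [sub_smul, one_smul, ← h1, sub_self]
  refine (smul_eq_zero.mp h3).resolve_left (sub_ne_zero.mpr ?_)
  rw [ne_eq, e_eq_one_iff, not_exists]
  exact ha

/-- The average keeps exactly the coefficients with `ρ ∣ r`; substituting `r = ρ r'` divides the
norm bound by `p` and gives index one. -/
theorem exists_avgB_eq_opU (h : IsSplitPrime σ p ρ) (hf : HasFourierExpansion σ p f c) :
    ∃ d, HasFourierExpansion σ 1 (opU (σ ρ)⁻¹ (avgB p (σ ρ) f)) d := by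
  classical
  have h0 := h.emb_ne_zero
  have h0' := h.conj_emb_ne_zero
  have h1 : HasFourierExpansion σ p (avgB p (σ ρ) f)
      (fun n r => (if ρ ∣ r then 1 else 0) * c n r) := by
    rw [avgB_apply]
    refine ((HasFourierExpansion.sum (s := Finset.range p) fun j _ =>
      hf.opB (j / σ ρ)).smul (1 / p)).congr fun n r => ?_
    rw [← h.sum_e_trDiff]
    simp only [Pi.smul_apply, Finset.sum_apply, smul_eq_mul]
    rw [mul_assoc, Finset.sum_mul]
    congr 1
    refine Finset.sum_congr rfl fun j _ => ?_
    rw [← trDiff_natCast_mul]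
    congr 4
    ring
  refine ⟨fun n r => c n (ρ * r), fun n r hn => ?_, fun τ z₁ z₂ => ?_⟩
  · have h2 := hf.1 n _ hn
    have h3 : nrm ρ = p := by
      have := nrm_eq σ ρ
      rw [h.emb_mul_conj] at this
      exact_mod_cast this
    rw [nrm_mul, h3, mul_comm] at h2
    simpa using Nat.le_of_mul_le_mul_right h2 h.prime_nat.pos
  · have h2 := h1.2 τ ((σ ρ)⁻¹ * z₁) (conj (σ ρ)⁻¹ * z₂)
    have hinj : Function.Injective (Prod.map (id : ℕ → ℕ) (fun r : 𝓞 K => ρ * r)) :=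
      Function.injective_id.prodMap (mul_right_injective₀ h.prime.ne_zero)
    rw [← hinj.hasSum_iff] at h2
    · refine (congrArg (fun F => HasSum F _) ?_).mpr h2
      funext ⟨n, r⟩
      simp only [Function.comp_apply, Prod.map_apply, id, dvd_mul_right, if_true, one_mul]
      congr 2
      rw [emb_mul, map_inv₀]
      simp only [map_div₀, map_mul]
      field_simp
    · rintro ⟨n, r⟩ hr
      have : ¬ ρ ∣ r := fun ⟨s, hs⟩ => hr ⟨(n, s), by simp [hs]⟩
      simp [this]

/-- Through `U_ρ` the remaining average over `opA` becomes an index one average over integral `j`,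
which preserves expansions and holomorphy. -/
theorem exists_avgA_avgB_eq_opU (h : IsSplitPrime σ p ρ) (hf : HasFourierExpansion σ p f c)
    (hol : IsHolomorphic f) :
    ∃ g d, IsHolomorphic g ∧ HasFourierExpansion σ 1 g d ∧
      avgA p (σ ρ) (avgB p (σ ρ) f) = opU (σ ρ) g := by
  have h0 := h.emb_ne_zero
  obtain ⟨d, hd⟩ := h.exists_avgB_eq_opU hf
  have h1 : avgB p (σ ρ) f = opU (σ ρ) (opU (σ ρ)⁻¹ (avgB p (σ ρ) f)) := by
    rw [opU_opU, mul_inv_cancel₀ h0, opU_one]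
  have h2 : IsHolomorphic (avgB p (σ ρ) f) := by
    rw [avgB_apply]
    exact (IsHolomorphic.sum fun j _ => hol.opB _).smul _
  refine ⟨(1 / p : ℂ) • ∑ j ∈ Finset.range p,
    opA 1 (σ (j : 𝓞 K)) (opU (σ ρ)⁻¹ (avgB p (σ ρ) f)), _, ?_,
    (HasFourierExpansion.sum
      (F := fun j : ℕ => opA 1 (σ (j : 𝓞 K)) (opU (σ ρ)⁻¹ (avgB p (σ ρ) f)))
      fun j _ => hd.opA one_pos (j : 𝓞 K)).smul (1 / p), ?_⟩
  · exact (IsHolomorphic.sum fun j _ => (h2.opU _).opA _ _).smul _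
  · conv_lhs => rw [h1]
    rw [avgA_apply, map_smul, map_sum]
    congr 1
    refine Finset.sum_congr rfl fun j _ => ?_
    rw [opA_opU _ _ _ h.emb_mul_conj, emb_natCast, mul_div_cancel₀ _ h0]

theorem hasFourierExpansion_opU (h : IsSplitPrime σ p ρ) (hf : HasFourierExpansion σ 1 f c) :
    ∃ d, HasFourierExpansion σ p (opU (σ ρ) f) d := by
  classical
  have hd : ∀ n r, (if hr : ρ ∣ ρ * r then c n hr.choose else 0) = c n r := by
    intro n r
    have hr := dvd_mul_right ρ r
    rw [dif_pos hr]
    congr 1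
    exact (mul_left_cancel₀ h.prime.ne_zero hr.choose_spec).symm
  refine ⟨fun n r => if hr : ρ ∣ r then c n hr.choose else 0, fun n r hn => ?_,
    fun τ z₁ z₂ => ?_⟩
  · by_cases hr : ρ ∣ r
    · obtain ⟨s, rfl⟩ := hr
      beta_reduce at hn
      rw [hd] at hn
      have h2 := hf.1 n _ hn
      have h3 : nrm ρ = p := by
        have := nrm_eq σ ρ
        rw [h.emb_mul_conj] at this
        exact_mod_cast this
      rw [nrm_mul, h3, mul_comm]
      exact Nat.mul_le_mul_right p (by simpa using h2)
    · simp [hr] at hn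
  · have h2 := hf.2 τ (σ ρ * z₁) (conj (σ ρ) * z₂)
    have hinj : Function.Injective (Prod.map (id : ℕ → ℕ) (fun r : 𝓞 K => ρ * r)) :=
      Function.injective_id.prodMap (mul_right_injective₀ h.prime.ne_zero)
    rw [← hinj.hasSum_iff]
    · refine (congrArg (fun F => HasSum F _) ?_).mpr h2
      funext ⟨n, r⟩
      simp only [Function.comp_apply, Prod.map_apply, id, hd]
      congr 2
      rw [emb_mul]
      simp only [map_div₀, map_mul]
      ring
    · rintro ⟨n, r⟩ hr
      have : ¬ ρ ∣ r := fun ⟨s, hs⟩ => hr ⟨(n, s), by simp [hs]⟩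
      simp [this]

theorem opU_mem_map (h : IsSplitPrime σ p ρ) {g : UpperHalfPlane → ℂ → ℂ → ℂ}
    (hol : IsHolomorphic g) (hF : HasFourierExpansion σ 1 g c)
    (hfix : opU (σ ρ) g ∈ fixedSubmodule σ p ρ)
    (hS : ∀ (ε : (𝓞 K)ˣ) (M : Matrix.SpecialLinearGroup (Fin 2) ℤ),
      opS k p (σ (ε : 𝓞 K)) M (opU (σ ρ) g) = opU (σ ρ) g) :
    opU (σ ρ) g ∈ (jacobiForms σ k 1).map (opU (σ ρ)) := by
  have h0 := h.emb_ne_zero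
  refine Submodule.mem_map_of_mem ⟨hol, fun ε M => ?_, fun l u => ?_, c, hF⟩
  · apply opU_injective h0
    rw [← opS_apply, ← opS_opU _ _ _ _ _ h.emb_mul_conj, hS]
  · have h1 : opA 1 (σ l) g = g := by
      apply opU_injective h0
      have := opA_opU g p (σ l / σ ρ) h.emb_mul_conj
      rwa [(hfix l).1, mul_div_cancel₀ _ h0, eq_comm] at this
    have h2 : opB (σ u) g = g := by
      apply opU_injective h0
      have := opB_opU g (σ u / σ ρ) (σ ρ)
      rwa [(hfix u).2, mul_div_cancel₀ _ h0, eq_comm] at this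
    rw [slashH_eq, h2, h1]

/-- A form of index `p` whose Fourier coefficients are supported on the integers divisible by
`ρ` or by `ρ̄` comes from forms of index one. -/
theorem mem_sup_map (h : IsSplitPrime σ p ρ) (hφ : φ ∈ jacobiForms σ k p)
    (hF : HasFourierExpansion σ p φ c) (hc : ∀ n r, c n r ≠ 0 → ρ ∣ r ∨ bar ρ ∣ r) :
    φ ∈ (jacobiForms σ k 1).map (opU (σ ρ)) ⊔ (jacobiForms σ k 1).map (opU (σ (bar ρ))) := by
  obtain ⟨hol, hU, hH, -⟩ := hφ
  have hB : ∀ l : 𝓞 K, opB (σ l) φ = φ := fun l => by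
    have := hH 0 l
    rwa [slashH_eq, (emb_eq_zero σ).mpr rfl, opA_zero] at this
  have hA : ∀ l : 𝓞 K, opA p (σ l) φ = φ := fun l => by
    have := hH l 0
    rwa [slashH_eq, (emb_eq_zero σ).mpr rfl, opB_zero] at this
  have hS : opS k p 1 ModularGroup.S φ = φ := by
    have := hU 1 ModularGroup.S
    simpa [opS_apply] using this
  have hε : ∀ ε : (𝓞 K)ˣ, σ (ε : 𝓞 K) * conj (σ (ε : 𝓞 K)) = 1 := fun ε => by
    rw [← nrm_eq σ, nrm, Int.natAbs_eq_natAbs_iff.mpr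
      (Int.isUnit_iff.mp (ε.isUnit.map (Algebra.norm ℤ)))]
    simp
  set G := component σ p ρ φ 0 1 with hG
  set φ₁ := component σ p ρ φ 0 0 - G with hφ₁
  set φ₂ := (p : ℂ) ^ 2 • avgA p (σ (bar ρ)) (avgB p (σ (bar ρ)) G) with hφ₂
  have hsum : φ = φ₁ + φ₂ := h.eq_add_component hF hc hS
  have h00 : component σ p ρ φ 0 0 = avgA p (σ ρ) (avgB p (σ ρ) φ) := by
    simp [component, opA_zero, opB_zero]
  have h01 : G = avgA p (σ ρ) (avgB p (σ ρ) (opB (σ 1 / σ (bar ρ)) φ)) := by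
    simp [hG, component, opA_zero]
  have hGmem : G ∈ fixedSubmodule σ p ρ := by
    rw [h01]
    refine h.avgA_avgB_mem (fun l => ?_) (fun l => ?_)
    · have := h.conj_prime.opB_opA_emb_comm l 1 φ
      simp only [map_one] at this ⊢
      rw [← this, hA]
    · rw [opB_comm, hB]
  have hφ₁mem : φ₁ ∈ fixedSubmodule σ p ρ :=
    Submodule.sub_mem _ (h00 ▸ h.avgA_avgB_mem hA hB) hGmem
  have hφ₂mem : φ₂ ∈ fixedSubmodule σ p (bar ρ) :=
    Submodule.smul_mem _ _ (h.conj_prime.avgA_avgB_mem (h.opA_emb_of_mem hGmem)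
      (h.opB_emb_of_mem hGmem))
  have hinv : ∀ (ε : (𝓞 K)ˣ) (M : Matrix.SpecialLinearGroup (Fin 2) ℤ),
      opS k p (σ (ε : 𝓞 K)) M φ₁ = φ₁ ∧ opS k p (σ (ε : 𝓞 K)) M φ₂ = φ₂ := by
    intro ε M
    have h1 : opS k p (σ (ε : 𝓞 K)) M φ₁ + opS k p (σ (ε : 𝓞 K)) M φ₂ = φ₁ + φ₂ := by
      rw [← map_add, ← hsum]
      exact hU ε M
    have h2 : opS k p (σ (ε : 𝓞 K)) M φ₁ - φ₁ = φ₂ - opS k p (σ (ε : 𝓞 K)) M φ₂ := by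
      rw [sub_eq_sub_iff_add_eq_add, h1, add_comm]
    -- The defect of invariance of `φ₁` is minus that of `φ₂`, so it is fixed by both families of
    -- operators.
    have h3 : opS k p (σ (ε : 𝓞 K)) M φ₁ - φ₁ = 0 := by
      refine h.eq_zero_of_mem (Submodule.sub_mem _ (h.opS_mem hφ₁mem ε (hε ε) M) hφ₁mem) ?_
      rw [h2]
      exact Submodule.sub_mem _ hφ₂mem (h.conj_prime.opS_mem hφ₂mem ε (hε ε) M)
    exact ⟨sub_eq_zero.mp h3, (sub_eq_zero.mp (h2 ▸ h3)).symm⟩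
  obtain ⟨g₀, d₀, hg₀, hd₀, he₀⟩ := h.exists_avgA_avgB_eq_opU hF hol
  obtain ⟨g₁, d₁, hg₁, hd₁, he₁⟩ := h.exists_avgA_avgB_eq_opU (hF.opB (σ 1 / σ (bar ρ)))
    (hol.opB (σ 1 / σ (bar ρ)))
  rw [← h01] at he₁
  -- To average `G` over `1/ρ̄` in turn, `G` needs an expansion of index `p`; it gets one as an
  -- image under `U_ρ`.
  obtain ⟨dG, hdG⟩ := h.hasFourierExpansion_opU hd₁
  obtain ⟨g₂, d₂, hg₂, hd₂, he₂⟩ := h.conj_prime.exists_avgA_avgB_eq_opU hdG (hg₁.opU _)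
  rw [← he₁] at he₂
  have e₁ : φ₁ = opU (σ ρ) (g₀ - g₁) := by rw [hφ₁, h00, he₀, he₁, map_sub]
  have e₂ : φ₂ = opU (σ (bar ρ)) ((p : ℂ) ^ 2 • g₂) := by rw [hφ₂, he₂, map_smul]
  rw [hsum]
  refine Submodule.add_mem_sup ?_ ?_
  · rw [e₁] at hφ₁mem hinv ⊢
    exact h.opU_mem_map (hg₀.sub hg₁) (hd₀.sub hd₁) hφ₁mem fun ε M => (hinv ε M).1
  · rw [e₂] at hφ₂mem hinv ⊢
    exact h.conj_prime.opU_mem_map (hg₂.smul _) (hd₂.smul _) hφ₂mem fun ε M => (hinv ε M).2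

end IsSplitPrime

end Descent

/-! ### Vanishing theta components have vanishing coefficients. -/

section Uniqueness

/-- With `w = e(τ/N)`, every point of the punctured unit disc occurs, so a power series in `w`
vanishes near `0`. -/
theorem eq_zero_of_tsum_e_eq_zero {a : ℕ → ℂ} {N : ℕ} (hN : 0 < N)
    (hs : ∀ τ : UpperHalfPlane, Summable fun n : ℕ => a n * e (n * τ / N))
    (h0 : ∀ τ : UpperHalfPlane, ∑' n : ℕ, a n * e (n * τ / N) = 0) (n : ℕ) : a n = 0 := by
  have hN' : (N : ℂ) ≠ 0 := by exact_mod_cast hN.ne'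
  have hw : ∀ w : ℂ, w ≠ 0 → ‖w‖ < 1 →
      ∃ τ : UpperHalfPlane, ∀ n : ℕ, e (n * τ / N) = w ^ n := by
    intro w hw hw1
    have him : 0 < ((N : ℂ) * (Complex.log w / (2 * Real.pi * I))).im := by
      have h1 : (N : ℂ) * (Complex.log w / (2 * Real.pi * I)) =
          -(((N / (2 * Real.pi) : ℝ) : ℂ) * (I * Complex.log w)) := by
        have : (Real.pi : ℂ) ≠ 0 := by exact_mod_cast Real.pi_ne_zero
        push_cast
        field_simp
        rw [I_sq]
        ring
      rw [h1, neg_im, im_ofReal_mul, I_mul_im, Complex.log_re, ← mul_neg]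
      have h2 : 0 < -Real.log ‖w‖ := neg_pos.mpr (Real.log_neg (norm_pos_iff.mpr hw) hw1)
      have h3 : (0 : ℝ) < N := by exact_mod_cast hN
      positivity
    refine ⟨⟨_, him⟩, fun n => ?_⟩
    have h1 : (n : ℂ) * ((N : ℂ) * (Complex.log w / (2 * Real.pi * I))) / N =
        n * (Complex.log w / (2 * Real.pi * I)) := by field_simp
    change e ((n : ℂ) * ((N : ℂ) * (Complex.log w / (2 * Real.pi * I))) / N) = _
    rw [h1, e_natCast_mul, e, mul_div_cancel₀ _ two_pi_I_ne_zero, Complex.exp_log hw]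
  set P := FormalMultilinearSeries.ofScalars ℂ a with hP
  have hsum : ∀ w : ℂ, w ≠ 0 → ‖w‖ < 1 → P.sum w = 0 := by
    intro w hw0 hw1
    obtain ⟨τ, hτ⟩ := hw w hw0 hw1
    have := h0 τ
    simp only [hτ] at this
    rw [FormalMultilinearSeries.sum, ← this]
    refine tsum_congr fun n => ?_
    rw [hP, FormalMultilinearSeries.ofScalars_apply_eq, smul_eq_mul]
  have hr : 0 < P.radius := by
    obtain ⟨τ, hτ⟩ := hw (1 / 2) (by norm_num) (by norm_num)
    have h1 := (hs τ).norm
    simp only [hτ] at h1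
    have h2 : ((1 / 2 : NNReal) : ENNReal) ≤ P.radius := by
      refine P.le_radius_of_summable_norm ?_
      refine h1.congr fun n => ?_
      rw [hP, FormalMultilinearSeries.ofScalars_norm]
      simp
    exact lt_of_lt_of_le (by simp) h2
  have hF : HasFPowerSeriesAt P.sum P 0 := (P.hasFPowerSeriesOnBall hr).hasFPowerSeriesAt
  have hev : ∀ᶠ w in nhds (0 : ℂ), P.sum w = 0 := by
    refine hF.analyticAt.eventually_eq_zero_or_eventually_ne_zero.resolve_right fun hne => ?_
    have h1 : ∀ᶠ w in nhdsWithin (0 : ℂ) {0}ᶜ, P.sum w = 0 := by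
      have h2 : ∀ᶠ w in nhdsWithin (0 : ℂ) {0}ᶜ, ‖w‖ < 1 :=
        nhdsWithin_le_nhds (by simpa [Metric.ball] using Metric.ball_mem_nhds (0 : ℂ) one_pos)
      filter_upwards [h2, self_mem_nhdsWithin] with w hw1 hw0
      exact hsum w hw0 hw1
    obtain ⟨w, hw1, hw2⟩ := (hne.and h1).exists
    exact hw1 hw2
  have hP0 : P = 0 := (hF.congr hev).eq_zero
  have := (FormalMultilinearSeries.ofScalars_series_eq_zero (E := ℂ)).mp hP0
  exact congrFun this n

variable {K : Type*} [Field K] [NumberField K] {σ : K →+* ℂ} {m : ℕ}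
  {φ : UpperHalfPlane → ℂ → ℂ → ℂ}

theorem fourierCoeff_spec (h : ∃ c, HasFourierExpansion σ m φ c) :
    HasFourierExpansion σ m φ (fourierCoeff σ m φ) := by
  rw [fourierCoeff, dif_pos h]
  exact h.choose_spec

theorem fourierCoeff_eq_zero_of_thetaComponent (hm : 0 < m)
    (hφ : ∃ c, HasFourierExpansion σ m φ c) {s : 𝓞 K}
    (hs : ∀ τ, thetaComponent σ m φ s τ = 0) (n : ℕ) : fourierCoeff σ m φ n s = 0 := by
  have hF := fourierCoeff_spec hφ
  simp only [thetaComponent] at hs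
  generalize fourierCoeff σ m φ = c at *
  by_contra hne
  set N := (discr K).natAbs * m with hNdef
  have hN : 0 < N := Nat.mul_pos (Int.natAbs_pos.mpr (discr_ne_zero K)) hm
  have hN' : (N : ℂ) ≠ 0 := by exact_mod_cast hN.ne'
  have hNC : ((discr K).natAbs : ℂ) * m = N := by rw [hNdef]; push_cast; rfl
  set a : ℕ → ℂ := fun n => if N ∣ n + nrm s then c ((n + nrm s) / N) s else 0 with ha
  have hterm : ∀ (τ : UpperHalfPlane) (n : ℕ), (if N ∣ n + nrm s then
      c ((n + nrm s) / N) s * e (n * τ / ((discr K).natAbs * m)) else 0) =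
        a n * e (n * τ / N) := by
    intro τ n
    rw [hNC, ha]
    split_ifs <;> simp_all
  have hbound : nrm s ≤ N * n := by
    have := hF.1 n s hne
    rw [hNdef]
    linarith
  have han : a (N * n - nrm s) = c n s := by
    rw [ha]
    simp only [Nat.sub_add_cancel hbound, dvd_mul_right, if_true, Nat.mul_div_cancel_left _ hN]
  refine hne (han ▸ eq_zero_of_tsum_e_eq_zero hN (fun τ => ?_) (fun τ => ?_) _)
  · have h1 := (hF.2 τ 0 0).summable.comp_injective
      (i := fun k : ℕ => (k, s)) (fun k k' h => (Prod.mk.inj h).1)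
    have hκ : Function.Injective
        (fun q : {n : ℕ | N ∣ n + nrm s} => ((q : ℕ) + nrm s) / N) := by
      rintro ⟨n, k, hk⟩ ⟨n', k', hk'⟩ h
      simp only [hk, hk', Nat.mul_div_cancel_left _ hN] at h
      subst h
      ext
      simp only
      omega
    -- At `z₁ = z₂ = 0` the terms `(k, s)` of the Jacobi expansion give the theta series after
    -- division by `e(N(s)τ/N)`, since `n + N(s) = N k`.
    have h2 := (h1.comp_injective hκ).mul_right (e (-(nrm s * τ / N)))
    have h3 : Summable (Set.indicator {n : ℕ | N ∣ n + nrm s}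
        (fun n : ℕ => c ((n + nrm s) / N) s * e (n * τ / N))) := by
      rw [← summable_subtype_iff_indicator]
      refine h2.congr fun ⟨n, k, hk⟩ => ?_
      simp only [Function.comp_apply, hk, Nat.mul_div_cancel_left _ hN]
      rw [mul_assoc, ← e_add]
      have h4 : (n : ℂ) + nrm s = N * k := by exact_mod_cast hk
      congr 2
      field_simp
      linear_combination -(τ : ℂ) * h4
    refine h3.congr fun n => ?_
    rw [← hterm, Set.indicator_apply, hNC]
    rfl
  · rw [← hs τ]
    exact tsum_congr fun n => (hterm τ n).symm

end Uniqueness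

/-! ### Consequences of `χ_D(p) = 1`. -/

section Kronecker

set_option linter.unusedSectionVars false

variable {K : Type*} [Field K] [NumberField K]
  [Algebra.IsQuadraticExtension ℚ K] [IsTotallyComplex K]

theorem sqrtDiscr_sq (σ : K →+* ℂ) : sqrtDiscr σ ^ 2 = (discr K : 𝓞 K) := by
  rw [← emb_inj σ, emb_intCast]
  have h : discr K = -((discr K).natAbs : ℤ) := by
    have := discr_neg (K := K)
    omega
  have h1 : σ ((sqrtDiscr σ ^ 2 : 𝓞 K) : K) = (I * (sqrtAbsDiscr K : ℂ)) ^ 2 := by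
    rw [← sqrtDiscr_spec σ]
    simp
  rw [h1, I_mul_sqrtAbsDiscr_sq]
  conv_rhs => rw [h]
  simp

theorem not_dvd_discr_of_kroneckerAtPrime {D : ℤ} {p : ℕ} (hp : p.Prime)
    (h : kroneckerAtPrime D p = 1) : ¬ (p : ℤ) ∣ D := by
  intro hd
  rw [kroneckerAtPrime] at h
  split_ifs at h with h2
  · subst h2
    have h3 := ZMod.χ₈_int_eq_if_mod_eight D
    rw [h, if_pos (Int.emod_eq_zero_of_dvd (by exact_mod_cast hd))] at h3
    exact one_ne_zero h3
  · have : NeZero p := ⟨hp.ne_zero⟩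
    have h3 : jacobiSym D p = 0 := by
      rw [jacobiSym.eq_zero_iff_not_coprime]
      intro hg
      have h4 := Int.dvd_coe_gcd hd (dvd_refl (p : ℤ))
      rw [hg] at h4
      exact hp.one_lt.ne' (by exact_mod_cast Int.eq_one_of_dvd_one (by positivity) h4)
    rw [h] at h3
    exact one_ne_zero h3

/-- If `tr(x/δ)` were always even, self-duality would make `1/2` integral. -/
theorem exists_odd_trDiffInt (σ : K →+* ℂ) : ∃ x : 𝓞 K, Odd (trDiffInt σ x) := by
  by_contra! h
  obtain ⟨a, ha⟩ := exists_trDiff_ne σ (1 / 2) (fun r hr => by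
    have h1 : ((2 : ℕ) : 𝓞 K) * r = ((1 : ℕ) : 𝓞 K) := by
      rw [← emb_inj σ, emb_mul, ← hr, emb_natCast, emb_natCast]
      norm_num
    have h2 := congrArg nrm h1
    have h3 : ∀ n : ℕ, nrm (n : 𝓞 K) = n ^ 2 := fun n => by
      have h4 := nrm_eq σ (n : 𝓞 K)
      rw [emb_natCast, map_natCast, ← pow_two] at h4
      exact_mod_cast h4
    rw [nrm_mul, h3, h3] at h2
    omega)
  have h1 := h a
  rw [Int.not_odd_iff_even] at h1
  obtain ⟨t, ht⟩ := h1
  refine ha t ?_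
  have h2 := trDiffInt_spec σ a
  rw [ht] at h2
  rw [trDiff] at h2 ⊢
  rw [div_eq_iff I_mul_sqrtAbsDiscr_ne_zero] at h2 ⊢
  push_cast at h2
  have h3 : conj (1 / 2 * σ a) = 1 / 2 * conj (σ a) := by
    rw [map_mul, map_div₀, map_one, map_ofNat]
  rw [h3]
  linear_combination h2 / 2

/-- If `χ_D(p) = 1` there is an integer whose norm is divisible by `p`, but whose trace is not. -/
theorem exists_dvd_nrm_not_dvd_trace (σ : K →+* ℂ) {p : ℕ} (hp : p.Prime)
    (h : kroneckerAtPrime (discr K) p = 1) : ∃ (y : 𝓞 K) (t : ℤ),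
      (p : 𝓞 K) ∣ y * bar y ∧ y + bar y = t ∧ ¬ (p : ℤ) ∣ t := by
  have hpD := not_dvd_discr_of_kroneckerAtPrime hp h
  rw [kroneckerAtPrime] at h
  split_ifs at h with h2
  · subst h2
    obtain ⟨x, a, hT⟩ := exists_odd_trDiffInt σ
    set t := Algebra.trace ℤ (𝓞 K) x with ht
    have h3 : x + bar x = t := add_bar x
    have h4 : x * bar x = (nrm x : 𝓞 K) := (natCast_nrm x).symm
    have h5 := sub_bar σ x
    have h6 : t ^ 2 - 4 * nrm x = trDiffInt σ x ^ 2 * discr K := by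
      have : ((t ^ 2 - 4 * nrm x : ℤ) : 𝓞 K) = ((trDiffInt σ x ^ 2 * discr K : ℤ) : 𝓞 K) := by
        push_cast
        rw [← sqrtDiscr_sq σ, ← h3, ← h4, ← mul_pow, ← h5]
        ring
      exact_mod_cast this
    have h7 := ZMod.χ₈_int_eq_if_mod_eight (discr K)
    rw [h] at h7
    have h8 : discr K % 8 = 1 ∨ discr K % 8 = 7 := by
      split_ifs at h7 with h9 h9
      · exact absurd h7 one_ne_zero
      · exact h9
    have h9 : Odd t := by
      rw [← Int.not_even_iff_odd]
      rintro ⟨b, hb⟩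
      have h10 : Odd (trDiffInt σ x ^ 2 * discr K) :=
        (Odd.pow ⟨a, hT⟩).mul (Int.odd_iff.mpr (by omega))
      rw [← h6, hb] at h10
      exact (Int.not_odd_iff_even.mpr ⟨2 * b ^ 2 - 2 * nrm x, by ring⟩) h10
    obtain ⟨b, hb⟩ := h9
    obtain ⟨A, hA⟩ := Int.even_mul_succ_self a
    obtain ⟨B, hB⟩ := Int.even_mul_succ_self b
    -- Odd squares are `1` modulo `8`, so `t² - 4N(x) = tr(x/δ)² D` becomes `1 - 4N(x) ≡ D` modulo
    -- `8`. This excludes `D ≡ 7` and makes `N(x)` even.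
    have h10 : 8 * B + 1 - 4 * nrm x = 8 * (A * discr K) + discr K := by
      have e1 : t ^ 2 = 8 * B + 1 := by rw [hb]; linear_combination 4 * hB
      have e2 : trDiffInt σ x ^ 2 = 8 * A + 1 := by rw [hT]; linear_combination 4 * hA
      rw [e1, e2] at h6
      linear_combination h6
    have h11 : 2 ∣ nrm x := by omega
    refine ⟨x, t, ?_, h3, ?_⟩
    · rw [h4]
      exact Nat.cast_dvd_cast h11
    · rw [hb]
      push_cast
      omega
  · have : Fact p.Prime := ⟨hp⟩
    obtain ⟨b, hb⟩ := ZMod.isSquare_of_jacobiSym_eq_one h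
    obtain ⟨b, rfl⟩ := ZMod.intCast_surjective b
    have h3 : (p : ℤ) ∣ b ^ 2 - discr K := by
      rw [← ZMod.intCast_zmod_eq_zero_iff_dvd]
      push_cast
      rw [hb]
      ring
    have hp' : Prime (p : ℤ) := Nat.prime_iff_prime_int.mp hp
    -- With `b² ≡ D` modulo `p`, the element `b + δ` has norm `b² - D` and trace `2b`.
    refine ⟨b + sqrtDiscr σ, 2 * b, ?_, ?_, fun h4 => ?_⟩
    · obtain ⟨t, ht⟩ := h3
      refine ⟨t, ?_⟩
      rw [bar_add, bar_intCast, bar_sqrtDiscr]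
      have h5 : ((b ^ 2 - discr K : ℤ) : 𝓞 K) = ((p * t : ℤ) : 𝓞 K) := by rw [ht]
      push_cast at h5
      linear_combination h5 - sqrtDiscr_sq σ
    · rw [bar_add, bar_intCast, bar_sqrtDiscr]
      push_cast
      ring
    · rcases hp'.dvd_or_dvd h4 with h5 | h5
      · have h6 := Int.le_of_dvd (by norm_num) h5
        have := hp.two_le
        omega
      · exact hpD ((dvd_sub_right (h5.pow two_ne_zero)).mp h3)

/-- If `ρ ∣ ρ̄`, divisibility by `ρ` would be stable under conjugation, so an element whose norm is
divisible by `p` would have trace divisible by `p`. If `ρ ∣ δ`, then `p ∣ D`. -/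
theorem isSplitPrime_of_kroneckerAtPrime (σ : K →+* ℂ) {p : ℕ} (hp : p.Prime)
    (h : kroneckerAtPrime (discr K) p = 1) {ρ : 𝓞 K} (hρ : Prime ρ)
    (hpρ : (p : ℂ) = σ ρ * conj (σ ρ)) : IsSplitPrime σ p ρ := by
  have hmul : ρ * bar ρ = p := by
    rw [← emb_inj σ, emb_mul, map_bar, ← hpρ, emb_natCast]
  have hint : ∀ n : ℤ, ρ ∣ (n : 𝓞 K) → (p : ℤ) ∣ n := by
    rintro n ⟨s, hs⟩
    have h1 : (p : 𝓞 K) * (s * bar s) = ((n ^ 2 : ℤ) : 𝓞 K) := by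
      have h2 : (n : 𝓞 K) = bar ρ * bar s := by
        rw [← bar_mul, ← hs, bar_intCast]
      push_cast
      rw [pow_two]
      conv_rhs =>
        congr
        · rw [hs]
        · rw [h2]
      rw [← hmul]
      ring
    rw [← natCast_nrm] at h1
    have h3 : (p : ℤ) * nrm s = n ^ 2 := by exact_mod_cast h1
    exact (Nat.prime_iff_prime_int.mp hp).dvd_of_dvd_pow ⟨_, h3.symm⟩
  refine ⟨hp, hρ, hmul, fun hd => ?_, fun hd => ?_⟩
  · obtain ⟨y, t, hy, ht, hpt⟩ := exists_dvd_nrm_not_dvd_trace σ hp h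
    have h1 : ∀ z : 𝓞 K, ρ ∣ z → ρ ∣ bar z := fun z hz => hd.trans (bar_dvd hz)
    have h2 : ρ ∣ y * bar y := (hmul ▸ dvd_mul_right ρ (bar ρ)).trans hy
    refine hpt (hint t (ht ▸ ?_))
    rcases hρ.dvd_or_dvd h2 with h3 | h3
    · exact dvd_add h3 (h1 y h3)
    · exact dvd_add (by simpa using h1 _ h3) h3
  · refine not_dvd_discr_of_kroneckerAtPrime hp h (hint _ ?_)
    rw [← sqrtDiscr_sq σ]
    exact dvd_pow hd two_ne_zero

end Kronecker

end HermitianJacobi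

theorem mainTheorem4 {K : Type*} [Field K] [NumberField K]
    [Algebra.IsQuadraticExtension ℚ K] [NumberField.IsTotallyComplex K]
    (hcl : NumberField.classNumber K = 1) (σ : K →+* ℂ)
    (k : ℤ) (hk : 0 < k) (p : ℕ) (hp : p.Prime)
    (hsplit : HermitianJacobi.kroneckerAtPrime (NumberField.discr K) p = 1)
    (ϖ : NumberField.RingOfIntegers K) (hϖ : Prime ϖ)
    (hpϖ : (p : ℂ) = σ ϖ * starRingEnd ℂ (σ ϖ))
    (φ : UpperHalfPlane → ℂ → ℂ → ℂ) (hφ : φ ∈ HermitianJacobi.jacobiForms σ k p)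
    (hs : ∀ s : NumberField.RingOfIntegers K,
      IsCoprime s (HermitianJacobi.sqrtDiscr σ * (p : NumberField.RingOfIntegers K)) →
        ∀ τ : UpperHalfPlane, HermitianJacobi.thetaComponent σ p φ s τ = 0) :
    φ ∈ (HermitianJacobi.jacobiForms σ k 1).map (HermitianJacobi.opU (σ ϖ)) ⊔
      (HermitianJacobi.jacobiForms σ k 1).map
        (HermitianJacobi.opU (starRingEnd ℂ (σ ϖ))) := by
  have : IsPrincipalIdealRing (NumberField.RingOfIntegers K) :=
    NumberField.classNumber_eq_one_iff.mp hcl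
  have h := HermitianJacobi.isSplitPrime_of_kroneckerAtPrime σ hp hsplit hϖ hpϖ
  rw [← HermitianJacobi.map_bar]
  have hE := hφ.2.2.2
  obtain ⟨c, hF, hc⟩ := HermitianJacobi.exists_expansion_of_vanish (σ := σ) (k := k)
    (c := HermitianJacobi.fourierCoeff σ p φ) hp.ne_zero
    (fun w hw hwδ hwp => by
      rw [← h.mul_bar] at hwp
      have hassoc : ∀ x y : NumberField.RingOfIntegers K, Prime x → Prime y → x ∣ y → y ∣ x :=
        fun x y hx hy hxy => (hx.irreducible.dvd_symm hy.irreducible hxy)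
      rcases hw.dvd_or_dvd hwp with h1 | h1
      · exact h.not_dvd_sqrtDiscr ((hassoc _ _ hw hϖ h1).trans hwδ)
      · exact h.conj_prime.not_dvd_sqrtDiscr
          ((hassoc _ _ hw h.conj_prime.prime h1).trans hwδ))
    (fun M => by
      have := hφ.2.1 1 M
      simpa [HermitianJacobi.opS_apply] using this)
    (fun l => by
      have := hφ.2.2.1 l 0
      rwa [HermitianJacobi.slashH_eq, (HermitianJacobi.emb_eq_zero σ).mpr rfl,
        HermitianJacobi.opB_zero] at this)
    (HermitianJacobi.fourierCoeff_spec hE)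
    (fun n r hr => HermitianJacobi.fourierCoeff_eq_zero_of_thetaComponent hp.pos hE (hs r hr) n)
  refine h.mem_sup_map hφ hF fun n r hr => h.not_coprime_natCast fun hr' => hr (hc n r hr')
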